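/- All graphs are finite, undirected and loopless, and may have parallel edges. The degree of a vertex is the number of distinct vertices adjacent to it, and the minimum degree of a graph is the minimum over its vertices. A graph $H$ is a minor of a graph $G$ if a graph isomorphic to $H$ can be obtained from $G$ by vertex removals, edge removals and edge contractions (loops that arise from a contraction being discarded). For $r\in\mathbb N$ let $\theta_r$ be the graph with two vertices and $r$ parallel edges between them. The $\theta_r$-girth of $G$ is the minimum number of edges of a subgraph of $G$ that contains $\theta_r$ as a minor, and it is $\infty$ if $G$ has no $\theta_r$ minor. **Theorem.** There is a constant $c>0$ such that for all integers $r\ge 2$, $d\ge 3r$ and $z\ge 2r$, every graph of minimum degree $d$ and $\theta_r$-girth at least $z$ contains as a minor a complete graph on $k$ vertices, for some integer $k$ with $$k\;\ge\;\frac{\left(\frac dr\right)^{c\,\frac zr}}{\sqrt{\frac zr\cdot\log_2 d}}.$$ -/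

import Mathlib

open scoped Graph

namespace ThetaGirth

universe u v u' v'

/-- The degree of `x` in a multigraph: the number of vertices adjacent to `x`
(parallel edges are not counted separately). -/
noncomputable def degree {α : Type u} {β : Type v} (G : Graph α β) (x : α) : ℕ :=
  {y | G.Adj x y}.ncard

/-- The minimum degree over all vertices (with value `0` for the graph without vertices). -/
noncomputable def minDegree {α : Type u} {β : Type v} (G : Graph α β) : ℕ :=
  sInf (degree G '' V(G))

open Classical in
/-- Contraction of the edges between the vertices `x` and `y`: these edges are removed and `y` is
identified with `x`. Every other edge keeps its identity, so parallel edges can arise, but no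
new loops do. -/
noncomputable def contract {α : Type u} {β : Type v} (G : Graph α β) (x y : α) : Graph α β :=
  (G.deleteEdges {e | G.IsLink e x y}).map (fun w => if w = y then x else w)

/-- `Step G G'`: the multigraph `G'` arises from `G` by one vertex removal, one edge removal or the
contraction of one edge. -/
inductive Step {α : Type u} {β : Type v} (G : Graph α β) : Graph α β → Prop
  | deleteVertex (x : α) (hx : x ∈ V(G)) : Step G (G.deleteVerts {x})
  | deleteEdge (e : β) (he : e ∈ E(G)) : Step G (G.deleteEdges {e})
  | contractEdge (e : β) (x y : α) (he : G.IsLink e x y) (hxy : x ≠ y) : Step G (contract G x y)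

/-- Isomorphism of multigraphs: bijections between the vertices and between the edges that
respect incidence. -/
def Isomorphic {α : Type u} {β : Type v} {α' : Type u'} {β' : Type v'}
    (G : Graph α β) (H : Graph α' β') : Prop :=
  ∃ (f : V(G) ≃ V(H)) (g : E(G) ≃ E(H)), ∀ (e : E(G)) (x y : V(G)),
    G.IsLink e x y ↔ H.IsLink (g e) (f x) (f y)

/-- `H` is a minor of `G`: up to isomorphism, `H` is obtained from `G` by a sequence of vertex
removals, edge removals and edge contractions. -/
def IsMinor {α : Type u} {β : Type v} {α' : Type u'} {β' : Type v'}
    (H : Graph α' β') (G : Graph α β) : Prop :=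
  ∃ G' : Graph α β, Relation.ReflTransGen Step G G' ∧ Isomorphic G' H

/-- An `H`-model in `G` is a subgraph of `G` that contains `H` as a minor. -/
def IsModel {α : Type u} {β : Type v} {α' : Type u'} {β' : Type v'}
    (H : Graph α' β') (G M : Graph α β) : Prop :=
  M ≤ G ∧ IsMinor H M

/-- The `H`-girth of `G`: the minimum number of edges of an `H`-model in `G`, and `⊤` if there is
no such model. -/
noncomputable def girth {α : Type u} {β : Type v} {α' : Type u'} {β' : Type v'}
    (H : Graph α' β') (G : Graph α β) : ℕ∞ :=
  sInf {n | ∃ M : Graph α β, IsModel H G M ∧ n = E(M).encard}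

/-- The multigraph `θ_r` with two vertices and `r` parallel edges between them. -/
def theta (r : ℕ) : Graph (Fin 2) (Fin r) :=
  Graph.banana 0 1 Set.univ

/-- The complete simple graph on `k` vertices, as a multigraph. -/
def clique (k : ℕ) : Graph (Fin k) (Sym2 (Fin k)) :=
  Graph.ofSimpleGraph (⊤ : SimpleGraph (Fin k))

end ThetaGirth

open scoped Graph

namespace ThetaGirth

universe u v u' v'

open Relation

/-! ### Branch models give minors. -/

section Minors

variable {α : Type u} {β : Type v} {α' : Type u'} {β' : Type v'}

/-! Fix a radius R of about z/(4r). Split the vertices into cells around a maximal set of centres at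
pairwise distance more than 2R, each cell carrying a tree of shortest paths to its centre. Two
disjoint connected sets joined by r edges span a θ_r-model, so together they use at least z edges
(`le_card_of_le_girth_theta`). Applied to unions of tree paths, which have length at most 2R, this
shows that a vertex has fewer than r neighbours in its own cell that are no further from the centre
(`card_low_neighbors_lt`), and that fewer than r edges join two given cells
(`card_edges_between_lt`).

Up to distance R from the centre, the levels of a cell therefore grow by a factor of at least d/r -
1, so a cell is exponentially large in z/r. At least a third of the edge ends at a cell belong to
edges leaving it, and these reach many different cells. Contracting the cells thus gives a graph of
minimum degree (d/r)^Ω(z/r) (`le_degree_quotient`).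

Minimum degree 24k² forces a complete minor on k vertices (`hasModel_top_of_le_degree`). The
quadratic bound is far from optimal, but it only halves the exponent, which the constant c absorbs.
The denominator in the theorem is at least 1 and is simply discarded. -/

lemma reflTransGen_step_deleteVerts (G : Graph α β) {S : Set α} (hS : S.Finite) (hSV : S ⊆ V(G)) :
    ReflTransGen Step G (G.deleteVerts S) := by
  induction S, hS using Set.Finite.induction_on with
  | empty => rw [Graph.deleteVerts_empty]
  | @insert a S ha hS ih =>
    refine (ih ((Set.subset_insert _ _).trans hSV)).tail ?_
    have h : G.deleteVerts (insert a S) = (G.deleteVerts S).deleteVerts {a} := by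
      apply Graph.ext
      · ext x
        simp only [Graph.vertexSet_deleteVerts, Set.mem_sdiff, Set.mem_insert_iff,
          Set.mem_singleton_iff]
        tauto
      · intro e x y
        simp only [Graph.deleteVerts_isLink, Set.mem_insert_iff, Set.mem_singleton_iff]
        tauto
    rw [h]
    exact Step.deleteVertex a (by simpa [ha] using hSV (Set.mem_insert _ _))

lemma reflTransGen_step_deleteEdges (G : Graph α β) {F : Set β} (hF : F.Finite) (hFE : F ⊆ E(G)) :
    ReflTransGen Step G (G.deleteEdges F) := by
  induction F, hF using Set.Finite.induction_on with
  | empty => rw [Graph.deleteEdges_empty]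
  | @insert a S ha hS ih =>
    refine (ih ((Set.subset_insert _ _).trans hFE)).tail ?_
    have h : G.deleteEdges (insert a S) = (G.deleteEdges S).deleteEdges {a} := by
      rw [Graph.deleteEdges_deleteEdges, Set.union_singleton]
    rw [h]
    exact Step.deleteEdge a (by simpa [ha] using hFE (Set.mem_insert _ _))

lemma exists_ne_of_reflTransGen {γ : Type*} {R : γ → γ → Prop} {a b : γ} (h : ReflTransGen R a b)
    (hab : a ≠ b) : ∃ x y, R x y ∧ x ≠ y := by
  induction h with
  | refl => exact absurd rfl hab
  | @tail c d _ hcd ih =>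
    by_cases hc : a = c
    · exact ⟨c, d, hcd, hc ▸ hab⟩
    · exact ih hc

/-- A branch model of `H` in `G`: the branch set of `i` is `{v ∈ V(G) | p v = some i}`, and the edge
`e` of `H` is represented by the edge `ε e` of `G`. -/
structure IsBranchModel (H : Graph α' β') (G : Graph α β) (p : α → Option α') (ε : β' → β) :
    Prop where
  mem : ∀ v ∈ V(G), ∀ i, p v = some i → i ∈ V(H)
  surj : ∀ i ∈ V(H), ∃ v ∈ V(G), p v = some i
  conn : ∀ u ∈ V(G), ∀ v ∈ V(G), ∀ i, p u = some i → p v = some i →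
    ReflTransGen (fun a b => G.Adj a b ∧ p a = some i ∧ p b = some i) u v
  inj : Set.InjOn ε E(H)
  link : ∀ e i j, H.IsLink e i j → ∃ u v, G.IsLink (ε e) u v ∧ p u = some i ∧ p v = some j

lemma IsBranchModel.deleteVerts {H : Graph α' β'} {G : Graph α β} {p : α → Option α'}
    {ε : β' → β} (h : IsBranchModel H G p ε) :
    IsBranchModel H (G.deleteVerts {v ∈ V(G) | p v = none}) p ε where
  mem v hv i hi := h.mem v (by simp at hv; exact hv.1) i hi
  surj i hi := by
    obtain ⟨v, hv, hvi⟩ := h.surj i hi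
    exact ⟨v, by simp [hv, hvi], hvi⟩
  conn u hu v hv i hui hvi := by
    simp at hu hv
    refine ReflTransGen.mono ?_ u v (h.conn u hu.1 v hv.1 i hui hvi)
    rintro a b ⟨⟨e, he⟩, ha, hb⟩
    exact ⟨⟨e, by simp [he, ha, hb]⟩, ha, hb⟩
  inj := h.inj
  link e i j hij := by
    obtain ⟨u, v, huv, hu, hv⟩ := h.link e i j hij
    exact ⟨u, v, by simp [huv, hu, hv], hu, hv⟩

/-- Both ends lie in one branch set, so `p` is compatible with the identification. As `H` is
loopless, no removed edge represents an edge of `H`. -/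
lemma IsBranchModel.contract {H : Graph α' β'} [H.Loopless] {G : Graph α β} {p : α → Option α'}
    {ε : β' → β} (h : IsBranchModel H G p ε) {x y : α} {k : α'}
    (hpx : p x = some k) (hpy : p y = some k) :
    IsBranchModel H (ThetaGirth.contract G x y) p ε := by
  classical
  set f : α → α := fun w => if w = y then x else w with hf
  have hpf : ∀ w, p (f w) = p w := by
    intro w
    simp only [hf]
    split_ifs with hw
    · rw [hw, hpx, hpy]
    · rfl
  have hG' : ThetaGirth.contract G x y = (G.deleteEdges {e | G.IsLink e x y}).map f := by
    simp only [ThetaGirth.contract, hf]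
  rw [hG']
  constructor
  · rintro v hv i hi
    obtain ⟨w, hw, rfl⟩ : ∃ w ∈ V(G), f w = v := by simpa using hv
    exact h.mem _ hw i (by rw [← hpf]; exact hi)
  · intro i hi
    obtain ⟨v, hv, hvi⟩ := h.surj i hi
    exact ⟨f v, by simpa using ⟨v, hv, rfl⟩, by rw [hpf, hvi]⟩
  · intro u hu v hv i hui hvi
    obtain ⟨u, hu', rfl⟩ : ∃ w ∈ V(G), f w = u := by simpa using hu
    obtain ⟨v, hv', rfl⟩ : ∃ w ∈ V(G), f w = v := by simpa using hv
    rw [hpf] at hui hvi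
    refine ReflTransGen.lift' f ?_ u v (h.conn u hu' v hv' i hui hvi)
    rintro a b ⟨⟨e, he⟩, ha, hb⟩
    by_cases hxy : G.IsLink e x y
    · have : f a = f b := by
        rcases he.eq_and_eq_or_eq_and_eq hxy with ⟨rfl, rfl⟩ | ⟨rfl, rfl⟩ <;> simp [hf]
      rw [Function.onFun, this]
    · refine ReflTransGen.single ⟨Graph.Adj.map f ⟨e, ?_⟩, by rw [hpf, ha], by rw [hpf, hb]⟩
      simp [he, hxy]
  · exact h.inj
  · intro e i j hij
    obtain ⟨u, v, huv, hu, hv⟩ := h.link e i j hij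
    refine ⟨f u, f v, Graph.IsLink.map f ?_, by rw [hpf, hu], by rw [hpf, hv]⟩
    have : ¬ G.IsLink (ε e) x y := by
      intro hxy
      have hne := hij.ne
      rcases huv.eq_and_eq_or_eq_and_eq hxy with ⟨rfl, rfl⟩ | ⟨rfl, rfl⟩ <;>
      · rw [hu] at *
        rw [hv] at *
        simp_all
    simp [huv, this]

/-- When the branch sets are singletons covering all vertices, only the edges that represent nothing
have to be removed. -/
lemma IsBranchModel.isMinor_of_injOn {H : Graph α' β'} {G : Graph α β} {p : α → Option α'}
    {ε : β' → β} (h : IsBranchModel H G p ε) (hE : E(G).Finite)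
    (hp : ∀ v ∈ V(G), p v ≠ none) (hinj : Set.InjOn p V(G)) : IsMinor H G := by
  refine ⟨G.deleteEdges (E(G) \ ε '' E(H)),
    reflTransGen_step_deleteEdges G (hE.subset Set.sdiff_subset) Set.sdiff_subset, ?_⟩
  set G' := G.deleteEdges (E(G) \ ε '' E(H)) with hG'
  have hlink : ∀ e x y, G'.IsLink e x y ↔ G.IsLink e x y ∧ e ∈ ε '' E(H) := by
    intro e x y
    simp only [hG', Graph.deleteEdges_isLink, Set.mem_sdiff, not_and, not_not]
    exact ⟨fun hh => ⟨hh.1, hh.2 hh.1.edge_mem⟩, fun hh => ⟨hh.1, fun _ => hh.2⟩⟩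
  have hV : V(G') = V(G) := by simp [hG']
  have hmem : ∀ e ∈ E(H), ε e ∈ E(G') := by
    intro e he
    obtain ⟨i, j, hij⟩ := Graph.exists_isLink_of_mem_edgeSet he
    obtain ⟨u, v, huv, -, -⟩ := h.link e i j hij
    exact ((hlink _ _ _).2 ⟨huv, e, he, rfl⟩).edge_mem
  choose s hsV hs using h.surj
  let f : V(H) ≃ V(G') := Equiv.ofBijective (fun i => ⟨s i i.2, hV ▸ hsV i i.2⟩) (by
    constructor
    · intro i j hij
      have h1 := congrArg p (congrArg Subtype.val hij)
      simp only [hs] at h1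
      exact Subtype.ext (Option.some_injective _ h1)
    · rintro ⟨v, hv⟩
      rw [hV] at hv
      obtain ⟨i, hi⟩ := Option.ne_none_iff_exists'.1 (hp v hv)
      have hiH := h.mem v hv i hi
      exact ⟨⟨i, hiH⟩, Subtype.ext (hinj (hsV i hiH) hv (by rw [hs, hi]))⟩)
  let g : E(H) ≃ E(G') := Equiv.ofBijective (fun e => ⟨ε e, hmem e e.2⟩) (by
    constructor
    · intro e e' he
      exact Subtype.ext (h.inj e.2 e'.2 (congrArg Subtype.val he))
    · rintro ⟨e, he⟩
      obtain ⟨x, y, hxy⟩ := Graph.exists_isLink_of_mem_edgeSet he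
      obtain ⟨-, e', he', rfl⟩ := (hlink _ _ _).1 hxy
      exact ⟨⟨e', he'⟩, rfl⟩)
  have hpf : ∀ i : V(H), p (f i) = some i.1 := fun i => hs i i.2
  have hg : ∀ e : E(H), (g e : β) = ε e := fun _ => rfl
  have key : ∀ (e : E(H)) (i j : V(H)), G'.IsLink (g e) (f i) (f j) ↔ H.IsLink e i j := by
    intro e i j
    rw [hlink, hg]
    constructor
    · rintro ⟨hl, -⟩
      obtain ⟨i', j', hij'⟩ := Graph.exists_isLink_of_mem_edgeSet e.2
      obtain ⟨u, v, huv, hu, hv⟩ := h.link _ _ _ hij'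
      rcases hl.eq_and_eq_or_eq_and_eq huv with ⟨h1, h2⟩ | ⟨h1, h2⟩
      · have e1 := hpf i
        have e2 := hpf j
        rw [h1, hu] at e1
        rw [h2, hv] at e2
        rw [← Option.some_injective _ e1, ← Option.some_injective _ e2]
        exact hij'
      · have e1 := hpf i
        have e2 := hpf j
        rw [h1, hv] at e1
        rw [h2, hu] at e2
        rw [← Option.some_injective _ e1, ← Option.some_injective _ e2]
        exact hij'.symm
    · intro hl
      obtain ⟨u, v, huv, hu, hv⟩ := h.link _ _ _ hl
      have e1 : u = f i := hinj huv.left_mem (hV.subset (f i).2) (by rw [hu, hpf])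
      have e2 : v = f j := hinj huv.right_mem (hV.subset (f j).2) (by rw [hv, hpf])
      subst e1 e2
      exact ⟨huv, e, e.2, rfl⟩
  refine ⟨f.symm, g.symm, fun e x y => ?_⟩
  rw [← key]
  simp

/-- Induction on the order: a branch set with two vertices is connected, hence contains an edge with
distinct ends, and contracting it loses a vertex. -/
lemma IsBranchModel.isMinor_of_ne_none {H : Graph α' β'} [H.Loopless] {ε : β' → β}
    {p : α → Option α'} (n : ℕ) : ∀ G : Graph α β, IsBranchModel H G p ε → V(G).Finite →
    E(G).Finite → (∀ v ∈ V(G), p v ≠ none) → V(G).ncard = n → IsMinor H G := by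
  induction n using Nat.strong_induction_on with
  | _ n ih =>
  intro G h hV hE hp hn
  by_cases hinj : Set.InjOn p V(G)
  · exact h.isMinor_of_injOn hE hp hinj
  obtain ⟨u, hu, v, hv, huv, hne⟩ : ∃ u ∈ V(G), ∃ v ∈ V(G), p u = p v ∧ u ≠ v := by
    simp only [Set.InjOn] at hinj
    push Not at hinj
    obtain ⟨u, hu, v, hv, h1, h2⟩ := hinj
    exact ⟨u, hu, v, hv, h1, h2⟩
  obtain ⟨i, hi⟩ := Option.ne_none_iff_exists'.1 (hp u hu)
  obtain ⟨x, y, ⟨⟨e, he⟩, hx, hy⟩, hxy⟩ :=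
    exists_ne_of_reflTransGen (h.conn u hu v hv i hi (huv ▸ hi)) hne
  have hsub : V(ThetaGirth.contract G x y) ⊆ V(G) \ {y} := by
    intro w hw
    simp only [ThetaGirth.contract, Graph.vertexSet_map, Graph.vertexSet_deleteEdges,
      Set.mem_image] at hw
    obtain ⟨w, hw, rfl⟩ := hw
    split_ifs with hwy
    · exact ⟨he.left_mem, hxy⟩
    · exact ⟨hw, hwy⟩
  have hVfin : (V(G) \ {y}).Finite := hV.subset Set.sdiff_subset
  have hlt : V(ThetaGirth.contract G x y).ncard < n := by
    rw [← hn]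
    exact (Set.ncard_le_ncard hsub hVfin).trans_lt
      (Set.ncard_sdiff_singleton_lt_of_mem he.right_mem hV)
  obtain ⟨G', hG', hiso⟩ := ih _ hlt (ThetaGirth.contract G x y)
    (h.contract hx hy) (hVfin.subset hsub)
    (hE.subset (by
      intro e he
      simp only [ThetaGirth.contract, Graph.edgeSet_map, Graph.edgeSet_deleteEdges] at he
      exact he.1))
    (fun v hv => hp v (hsub hv).1) rfl
  exact ⟨G', ReflTransGen.head (Step.contractEdge e x y he hxy) hG', hiso⟩

/-- A graph with a branch model of `H` has `H` as a minor. -/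
theorem IsBranchModel.isMinor {H : Graph α' β'} [H.Loopless] {G : Graph α β} {ε : β' → β}
    {p : α → Option α'} (h : IsBranchModel H G p ε) (hV : V(G).Finite) (hE : E(G).Finite) :
    IsMinor H G := by
  obtain ⟨G', hG', hiso⟩ := h.deleteVerts.isMinor_of_ne_none _ _
    (hV.subset (by simp)) (hE.subset Graph.deleteVerts_le.edgeSet_mono)
    (by intro v hv; simp at hv; exact hv.2) rfl
  exact ⟨G', (reflTransGen_step_deleteVerts G (hV.subset (Set.sep_subset _ _))
    (Set.sep_subset _ _)).trans hG', hiso⟩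

end Minors

/-! ### Minor models between simple graphs. -/

section Models

lemma exists_partial_map {V W : Type*} {S : V → W → Prop}
    (hS : ∀ v w w', S v w → S v w' → w = w') :
    ∃ p : V → Option W, ∀ v w, p v = some w ↔ S v w := by
  classical
  refine ⟨fun v => if h : ∃ w, S v w then some h.choose else none, fun v w => ?_⟩
  by_cases h : ∃ w, S v w
  · simp only [h, dite_true, Option.some_inj]
    exact ⟨fun hw => hw ▸ h.choose_spec, fun hw => hS v _ _ h.choose_spec hw⟩
  · simp only [h, dite_false]
    simp only [reduceCtorEq, false_iff]
    exact fun hw => h ⟨w, hw⟩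

variable {U V W : Type*}

/-- `HasModel H G`: the simple graph `H` is a minor of the simple graph `G`, witnessed by
a partial map `p` whose fibres are the branch sets. -/
def HasModel (H : SimpleGraph W) (G : SimpleGraph V) : Prop :=
  ∃ p : V → Option W, (∀ w, ∃ v, p v = some w) ∧
    (∀ w u v, p u = some w → p v = some w →
      ReflTransGen (fun a b => G.Adj a b ∧ p a = some w ∧ p b = some w) u v) ∧
    ∀ w w', H.Adj w w' → ∃ u v, p u = some w ∧ p v = some w' ∧ G.Adj u v

lemma HasModel.trans {H : SimpleGraph U} {K : SimpleGraph W} {G : SimpleGraph V}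
    (hHK : HasModel H K) (hKG : HasModel K G) : HasModel H G := by
  obtain ⟨p, hp1, hp2, hp3⟩ := hHK
  obtain ⟨q, hq1, hq2, hq3⟩ := hKG
  refine ⟨fun v => (q v).bind p, ?_, ?_, ?_⟩
  · intro w
    obtain ⟨x, hx⟩ := hp1 w
    obtain ⟨v, hv⟩ := hq1 x
    exact ⟨v, by simp [hv, hx]⟩
  · intro w u v hu hv
    obtain ⟨a, ha, ha'⟩ := Option.bind_eq_some_iff.1 hu
    obtain ⟨b, hb, hb'⟩ := Option.bind_eq_some_iff.1 hv
    have lift : ∀ x, p x = some w → ∀ u v, q u = some x → q v = some x → ReflTransGen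
        (fun a b => G.Adj a b ∧ (q a).bind p = some w ∧ (q b).bind p = some w) u v := by
      intro x hx u v hu hv
      refine ReflTransGen.mono ?_ u v (hq2 x u v hu hv)
      rintro c d ⟨h1, h2, h3⟩
      exact ⟨h1, by simp [h2, hx], by simp [h3, hx]⟩
    have main := hp2 w a b ha' hb'
    clear hv
    induction main generalizing v with
    | refl => exact lift a ha' u v ha hb
    | @tail c d _ hcd ih =>
      obtain ⟨s, t, hs, ht, hst⟩ := hq3 _ _ hcd.1
      refine ((ih s hs hcd.2.1).tail ⟨hst, ?_, ?_⟩).trans (lift d hcd.2.2 t v ht hb)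
      · simp [hs, hcd.2.1]
      · simp [ht, hcd.2.2]
  · intro w w' h
    obtain ⟨a, b, ha, hb, hab⟩ := hp3 w w' h
    obtain ⟨u, v, hu, hv, huv⟩ := hq3 a b hab
    exact ⟨u, v, by simp [hu, ha], by simp [hv, hb], huv⟩

lemma HasModel.of_embedding {H : SimpleGraph W} {G : SimpleGraph V} (f : W ↪ V)
    (hf : ∀ a b, H.Adj a b → G.Adj (f a) (f b)) : HasModel H G := by
  obtain ⟨p, hp⟩ := exists_partial_map (S := fun v w => f w = v)
    fun v w w' h h' => f.injective (h.trans h'.symm)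
  refine ⟨p, ?_, ?_, ?_⟩
  · exact fun w => ⟨f w, (hp _ _).2 rfl⟩
  · intro w u v hu hv
    rw [← (hp _ _).1 hu, ← (hp _ _).1 hv]
  · intro w w' h
    exact ⟨f w, f w', (hp _ _).2 rfl, (hp _ _).2 rfl, hf _ _ h⟩

lemma hasModel_top_fin_two {G : SimpleGraph V} {a b : V} (h : G.Adj a b) :
    HasModel (⊤ : SimpleGraph (Fin 2)) G := by
  refine HasModel.of_embedding ⟨![a, b], ?_⟩ ?_
  · intro i j hij
    fin_cases i <;> fin_cases j <;> simp_all [h.ne, h.ne.symm]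
  · intro i j hij
    fin_cases i <;> fin_cases j
    exacts [absurd rfl hij, h, h.symm, absurd rfl hij]

end Models

/-! ### From the multigraph to its underlying simple graph and back. -/

section Multigraph

variable {α : Type u} {β : Type v}

instance theta_loopless (r : ℕ) : (theta r).Loopless where
  not_isLoopAt e x h := by
    simp only [theta, Graph.banana_isLoopAt] at h
    exact absurd h.2.2 (by decide)

lemma clique_isLink {k : ℕ} {e : Sym2 (Fin k)} {i j : Fin k} :
    (clique k).IsLink e i j ↔ i ≠ j ∧ e = s(i, j) := by
  constructor
  · rintro ⟨rfl, h⟩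
    exact ⟨by simpa using h, rfl⟩
  · rintro ⟨h, rfl⟩
    exact ⟨rfl, by simpa using h⟩

instance clique_loopless (k : ℕ) : (clique k).Loopless where
  not_isLoopAt _ _ h := (clique_isLink.1 h).1 rfl

/-- One edge is selected from each parallel class. Indexing by unordered pairs makes both
orientations select the same edge; injectivity holds since an edge determines its ends. -/
lemma exists_edge_choice (G : Graph α β) [G.Loopless] [Nonempty β] :
    ∃ η : Sym2 V(G) → β, (∀ x y, G.toSimpleGraph.Adj x y → G.IsLink (η s(x, y)) x y) ∧
      Set.InjOn η G.toSimpleGraph.edgeSet := by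
  have h : ∀ s : Sym2 V(G), ∃ e : β, ∀ x y, s = s(x, y) → G.toSimpleGraph.Adj x y →
      G.IsLink e x y := by
    intro s
    induction s using Sym2.ind with
    | _ x y =>
    by_cases hxy : G.toSimpleGraph.Adj x y
    · obtain ⟨e, he⟩ := (Graph.toSimpleGraph_adj_iff x y).1 hxy
      refine ⟨e, fun x' y' hs _ => ?_⟩
      rcases Sym2.eq_iff.1 hs with ⟨rfl, rfl⟩ | ⟨rfl, rfl⟩
      · exact he
      · exact he.symm
    · refine ⟨Classical.arbitrary β, fun x' y' hs h' => absurd ?_ hxy⟩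
      rcases Sym2.eq_iff.1 hs with ⟨rfl, rfl⟩ | ⟨rfl, rfl⟩
      · exact h'
      · exact h'.symm
  choose η hη using h
  refine ⟨η, fun x y hxy => hη _ x y rfl hxy, ?_⟩
  intro s hs t ht hst
  induction s using Sym2.ind with
  | _ x y =>
  induction t using Sym2.ind with
  | _ x' y' =>
  have h1 := hη _ x y rfl hs
  have h2 := hη _ x' y' rfl ht
  rw [hst] at h1
  rcases h1.eq_and_eq_or_eq_and_eq h2 with ⟨h3, h4⟩ | ⟨h3, h4⟩
  · rw [Subtype.ext h3, Subtype.ext h4]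
  · rw [Subtype.ext h3, Subtype.ext h4, Sym2.eq_swap]

/-- A clique model in the underlying simple graph gives a clique minor of the multigraph. -/
lemma isMinor_clique_of_hasModel {G : Graph α β} [G.Loopless] [Nonempty β] (hV : V(G).Finite)
    (hE : E(G).Finite) {k : ℕ} (h : HasModel (⊤ : SimpleGraph (Fin k)) G.toSimpleGraph) :
    IsMinor (clique k) G := by
  classical
  obtain ⟨p, hp1, hp2, hp3⟩ := h
  obtain ⟨η, hη, hηinj⟩ := exists_edge_choice G
  -- The representing pair is chosen per unordered pair {i, j}, so that the two orientations of a
  -- clique edge share it; diagonal pairs get a dummy value.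
  have h : ∀ s : Sym2 (Fin k), ∃ t : Sym2 V(G), ∀ i j, s = s(i, j) → i ≠ j →
      ∃ u v, p u = some i ∧ p v = some j ∧ G.toSimpleGraph.Adj u v ∧ t = s(u, v) := by
    intro s
    induction s using Sym2.ind with
    | _ i j =>
    by_cases hij : i = j
    · obtain ⟨v, -⟩ := hp1 i
      refine ⟨s(v, v), fun i' j' hs hne => absurd ?_ hne⟩
      rcases Sym2.eq_iff.1 hs with ⟨rfl, rfl⟩ | ⟨rfl, rfl⟩
      · exact hij
      · exact hij.symm
    · obtain ⟨u, v, hu, hv, huv⟩ := hp3 i j hij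
      refine ⟨s(u, v), fun i' j' hs hne => ?_⟩
      rcases Sym2.eq_iff.1 hs with ⟨rfl, rfl⟩ | ⟨rfl, rfl⟩
      · exact ⟨u, v, hu, hv, huv, rfl⟩
      · exact ⟨v, u, hv, hu, huv.symm, Sym2.eq_swap⟩
  choose τ hτ using h
  let q : α → Option (Fin k) := fun x => if hx : x ∈ V(G) then p ⟨x, hx⟩ else none
  have hq : ∀ x : V(G), q x = p x := fun x => by simp [q]
  have hmodel : IsBranchModel (clique k) G q (fun s => η (τ s)) := by
    refine ⟨fun _ _ _ _ => Set.mem_univ _, ?_, ?_, ?_, ?_⟩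
    · intro i _
      obtain ⟨v, hv⟩ := hp1 i
      exact ⟨v, v.2, by rw [hq, hv]⟩
    · intro u hu v hv i hui hvi
      lift u to V(G) using hu
      lift v to V(G) using hv
      rw [hq] at hui hvi
      refine ReflTransGen.lift Subtype.val ?_ u v (hp2 i u v hui hvi)
      rintro a b ⟨h1, h2, h3⟩
      exact ⟨(Graph.toSimpleGraph_adj_iff a b).1 h1, by rw [hq, h2], by rw [hq, h3]⟩
    · intro s hs t ht hst
      obtain ⟨i, j, hij⟩ := Graph.exists_isLink_of_mem_edgeSet hs
      obtain ⟨i', j', hij'⟩ := Graph.exists_isLink_of_mem_edgeSet ht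
      obtain ⟨hne, rfl⟩ := clique_isLink.1 hij
      obtain ⟨hne', rfl⟩ := clique_isLink.1 hij'
      obtain ⟨u, v, hu, hv, huv, h1⟩ := hτ _ i j rfl hne
      obtain ⟨u', v', hu', hv', huv', h1'⟩ := hτ _ i' j' rfl hne'
      have h2 : τ s(i, j) = τ s(i', j') :=
        hηinj (by rw [h1]; exact huv) (by rw [h1']; exact huv') hst
      rw [h1, h1'] at h2
      rcases Sym2.eq_iff.1 h2 with ⟨rfl, rfl⟩ | ⟨rfl, rfl⟩
      · rw [hu] at hu'
        rw [hv] at hv'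
        rw [Option.some_injective _ hu', Option.some_injective _ hv']
      · rw [hu] at hv'
        rw [hv] at hu'
        rw [Option.some_injective _ hu', Option.some_injective _ hv', Sym2.eq_swap]
    · intro e i j hij
      obtain ⟨hne, rfl⟩ := clique_isLink.1 hij
      obtain ⟨u, v, hu, hv, huv, h1⟩ := hτ _ i j rfl hne
      exact ⟨u, v, by simp only [h1]; exact hη u v huv, by rw [hq, hu], by rw [hq, hv]⟩
  exact hmodel.isMinor hV hE

/-- Any two vertices of `A` are joined by a path inside `A` with edges from `P`. -/
def ConnectedBy {V : Type*} (P : Finset (Sym2 V)) (A : Set V) : Prop :=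
  ∀ a ∈ A, ∀ b ∈ A, ReflTransGen (fun x y => s(x, y) ∈ P ∧ x ∈ A ∧ y ∈ A) a b

/-- Two disjoint connected sets joined by `r` edges span a `θ_r`-model. -/
lemma le_card_of_le_girth_theta {G : Graph α β} [G.Loopless] (hV : V(G).Finite)
    (hE : E(G).Finite) {r z : ℕ} (hr : 0 < r)
    (hz : (z : ℕ∞) ≤ girth (theta r) G) {A B : Set V(G)} (hAB : Disjoint A B)
    {P Q : Finset (Sym2 V(G))} (hP : ConnectedBy P A) (hQ : ConnectedBy Q B)
    (hPG : ↑P ⊆ G.toSimpleGraph.edgeSet) (hQG : ↑Q ⊆ G.toSimpleGraph.edgeSet)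
    {F : Finset (V(G) × V(G))} (hF : F.card = r)
    (hFG : ∀ e ∈ F, e.1 ∈ A ∧ e.2 ∈ B ∧ G.toSimpleGraph.Adj e.1 e.2) :
    z ≤ P.card + Q.card + r := by
  classical
  obtain ⟨e₀, he₀⟩ : F.Nonempty := Finset.card_pos.1 (hF ▸ hr)
  obtain ⟨b₀, hb₀⟩ := (Graph.toSimpleGraph_adj_iff _ _).1 (hFG e₀ he₀).2.2
  have : Nonempty β := ⟨b₀⟩
  obtain ⟨η, hη, hηinj⟩ := exists_edge_choice G
  let T : Finset (Sym2 V(G)) := P ∪ Q ∪ F.image (fun e => s(e.1, e.2))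
  -- All vertices are kept, since only edges are counted, and each pair in `T` contributes a single
  -- edge.
  let M : Graph α β := G.restrict (T.image η)
  have hTcard : T.card ≤ P.card + Q.card + r := by
    refine (Finset.card_union_le _ _).trans (Nat.add_le_add (Finset.card_union_le _ _) ?_)
    exact hF ▸ Finset.card_image_le
  have hMadj : ∀ x y : V(G), G.toSimpleGraph.Adj x y → s(x, y) ∈ T → M.IsLink (η s(x, y)) x y := by
    intro x y hxy hT
    simp only [M, Graph.restrict_isLink]
    exact ⟨Finset.mem_coe.2 (Finset.mem_image_of_mem η hT), hη x y hxy⟩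
  let q : α → Option (Fin 2) := fun x =>
    if x ∈ Subtype.val '' A then some 0 else if x ∈ Subtype.val '' B then some 1 else none
  have hq0 : ∀ x : V(G), q x = some 0 ↔ x ∈ A := by
    intro x
    simp only [q, Set.mem_image, Subtype.val_inj, exists_eq_right]
    by_cases h : x ∈ A
    · simp [h]
    · by_cases h' : x ∈ B <;> simp [h, h']
  have hq1 : ∀ x : V(G), q x = some 1 ↔ x ∈ B := by
    intro x
    simp only [q, Set.mem_image, Subtype.val_inj, exists_eq_right]
    by_cases h : x ∈ A
    · simp [h, Set.disjoint_left.1 hAB h]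
    · by_cases h' : x ∈ B <;> simp [h, h']
  let ι : Fin r ≃ F := (F.equivFinOfCardEq hF).symm
  have hconn : ∀ (C : Set V(G)) (S : Finset (Sym2 V(G))) (i : Fin 2), ConnectedBy S C → S ⊆ T →
      ↑S ⊆ G.toSimpleGraph.edgeSet → (∀ x : V(G), q x = some i ↔ x ∈ C) → ∀ u v : V(G),
      q u = some i → q v = some i →
      ReflTransGen (fun a b => M.Adj a b ∧ q a = some i ∧ q b = some i) (u : α) v := by
    intro C S i hC hST hSG hqi u v hu hv
    refine ReflTransGen.lift Subtype.val ?_ u v (hC u ((hqi u).1 hu) v ((hqi v).1 hv))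
    rintro a b ⟨h1, h2, h3⟩
    exact ⟨⟨_, hMadj a b (hSG h1) (hST h1)⟩, (hqi a).2 h2, (hqi b).2 h3⟩
  have hmodel : IsBranchModel (theta r) M q
      (fun i => η s((ι i : V(G) × V(G)).1, (ι i : V(G) × V(G)).2)) := by
    refine ⟨?_, ?_, ?_, ?_, ?_⟩
    · intro _ _ i _
      fin_cases i <;> simp [theta]
    · intro i _
      fin_cases i
      · exact ⟨e₀.1, e₀.1.2, (hq0 _).2 (hFG e₀ he₀).1⟩
      · exact ⟨e₀.2, e₀.2.2, (hq1 _).2 (hFG e₀ he₀).2.1⟩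
    · intro u hu v hv i hui hvi
      have hu' : u ∈ V(G) := hu
      have hv' : v ∈ V(G) := hv
      lift u to V(G) using hu'
      lift v to V(G) using hv'
      fin_cases i
      · exact hconn A P 0 hP (fun x hx => by simp [T, hx]) hPG hq0 u v hui hvi
      · exact hconn B Q 1 hQ (fun x hx => by simp [T, hx]) hQG hq1 u v hui hvi
    · intro i _ j _ hij
      have hi := hFG _ (ι i).2
      have hj := hFG _ (ι j).2
      have h := hηinj hi.2.2 hj.2.2 hij
      rcases Sym2.eq_iff.1 h with ⟨h1, h2⟩ | ⟨h1, h2⟩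
      · exact ι.injective (Subtype.ext (Prod.ext h1 h2))
      · exact absurd (h1 ▸ hi.1) (Set.disjoint_right.1 hAB hj.2.1)
    · intro e i j hij
      have he := hFG _ (ι e).2
      have hl := hMadj _ _ he.2.2 (by
        simp only [T, Finset.mem_union, Finset.mem_image]
        exact Or.inr ⟨_, (ι e).2, rfl⟩)
      have hij' : s(i, j) = s(0, 1) := by simpa [theta] using hij
      rcases Sym2.eq_iff.1 hij' with ⟨rfl, rfl⟩ | ⟨rfl, rfl⟩
      · exact ⟨_, _, hl, (hq0 _).2 he.1, (hq1 _).2 he.2.1⟩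
      · exact ⟨_, _, hl.symm, (hq1 _).2 he.2.1, (hq0 _).2 he.1⟩
  have hM : IsModel (theta r) G M := ⟨Graph.restrict_le,
    hmodel.isMinor hV (hE.subset Graph.restrict_le.edgeSet_mono)⟩
  have h1 : (z : ℕ∞) ≤ E(M).encard := hz.trans (sInf_le ⟨M, hM, rfl⟩)
  have h2 : E(M).encard ≤ (T.image η).card := by
    rw [← Set.encard_coe_eq_coe_finsetCard]
    exact Set.encard_le_encard (by simp [M])
  have h3 : z ≤ (T.image η).card := by exact_mod_cast h1.trans h2
  exact (h3.trans Finset.card_image_le).trans hTcard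

end Multigraph

/-! ### Dense graphs have large complete minors. -/

section EdgeDensity

lemma ncard_incidenceSet {W : Type u} (H : SimpleGraph W) (v : W) :
    (H.incidenceSet v).ncard = (H.neighborSet v).ncard := by
  classical
  exact Set.ncard_congr' (H.incidenceSetEquivNeighborSet v)

variable {W : Type u} [Fintype W]

lemma sum_ncard_neighborSet (H : SimpleGraph W) :
    ∑ v, (H.neighborSet v).ncard = 2 * H.edgeSet.ncard := by
  classical
  have h := H.sum_degrees_eq_twice_card_edges
  simp only [SimpleGraph.degree, SimpleGraph.neighborFinset, SimpleGraph.edgeFinset] at h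
  simpa only [Set.ncard_eq_toFinset_card'] using h

lemma exists_hasModel_deleteVertex (H : SimpleGraph W) (v : W) :
    ∃ H' : SimpleGraph {w // w ≠ v}, HasModel H' H ∧
      H.edgeSet.ncard ≤ H'.edgeSet.ncard + (H.neighborSet v).ncard := by
  classical
  refine ⟨H.comap Subtype.val, HasModel.of_embedding (Function.Embedding.subtype _)
    (fun a b h => h), ?_⟩
  rw [← ncard_incidenceSet]
  have h : H.edgeSet ⊆ Sym2.map Subtype.val '' (H.comap (Subtype.val : {w // w ≠ v} → W)).edgeSet ∪
      H.incidenceSet v := by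
    intro e he
    by_cases hv : v ∈ e
    · exact Or.inr ⟨he, hv⟩
    · left
      induction e using Sym2.ind with
      | _ x y =>
      simp only [Sym2.mem_iff, not_or] at hv
      exact ⟨s(⟨x, Ne.symm hv.1⟩, ⟨y, Ne.symm hv.2⟩), he, rfl⟩
  refine (Set.ncard_le_ncard h (Set.toFinite _)).trans ((Set.ncard_union_le _ _).trans ?_)
  exact Nat.add_le_add_right (Set.ncard_image_le (Set.toFinite _)) _

/-- Contracting uv destroys this edge and merges two edges into one for every common neighbour of u
and v; nothing else is lost. -/
lemma exists_hasModel_contract (H : SimpleGraph W) {u v : W} (huv : H.Adj u v) :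
    ∃ H' : SimpleGraph {w // w ≠ v}, HasModel H' H ∧
      H.edgeSet.ncard ≤ H'.edgeSet.ncard + 1 + (H.neighborSet v ∩ H.neighborSet u).ncard := by
  classical
  let f : W → {w // w ≠ v} := fun w => if h : w = v then ⟨u, huv.ne⟩ else ⟨w, h⟩
  have hfv : f v = ⟨u, huv.ne⟩ := by simp [f]
  have hfw : ∀ w (h : w ≠ v), f w = ⟨w, h⟩ := fun w h => by simp [f, h]
  let H' : SimpleGraph {w // w ≠ v} := SimpleGraph.mk
    (fun a b => a ≠ b ∧ ∃ x y, H.Adj x y ∧ f x = a ∧ f y = b)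
    ⟨fun a b h => ⟨h.1.symm, by obtain ⟨x, y, h1, h2, h3⟩ := h.2; exact ⟨y, x, h1.symm, h3, h2⟩⟩⟩
    ⟨fun a h => h.1 rfl⟩
  refine ⟨H', ⟨fun w => some (f w), ?_, ?_, ?_⟩, ?_⟩
  · exact fun w => ⟨w, congrArg some (hfw w.1 w.2)⟩
  · have key : ∀ w x, f x = w → ReflTransGen
        (fun a b => H.Adj a b ∧ some (f a) = some w ∧ some (f b) = some w) x w ∧ ReflTransGen
        (fun a b => H.Adj a b ∧ some (f a) = some w ∧ some (f b) = some w) w x := by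
      intro w x hx
      by_cases hxv : x = v
      · subst hxv
        have hw : w = ⟨u, huv.ne⟩ := by rw [← hx, hfv]
        subst hw
        have := hfw u huv.ne
        exact ⟨ReflTransGen.single ⟨huv.symm, by rw [hfv], by rw [this]⟩,
          ReflTransGen.single ⟨huv, by rw [this], by rw [hfv]⟩⟩
      · rw [hfw x hxv] at hx
        subst hx
        exact ⟨ReflTransGen.refl, ReflTransGen.refl⟩
    intro w x y hx hy
    exact (key w x (Option.some_injective _ hx)).1.trans (key w y (Option.some_injective _ hy)).2
  · rintro a b ⟨-, x, y, hxy, rfl, rfl⟩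
    exact ⟨x, y, rfl, rfl, hxy⟩
  -- For w in `N`, the edge vw survives as uw, which was not an edge before.
  · set N := (H.neighborSet v \ H.neighborSet u) \ {u} with hN
    have h1 : (H.edgeSet \ H.incidenceSet v) ∪ (fun w => s(u, w)) '' N ⊆
        Sym2.map Subtype.val '' H'.edgeSet := by
      rintro e (⟨he, hv⟩ | ⟨w, ⟨⟨hwv, hwu⟩, hne⟩, rfl⟩)
      · have hv : v ∉ e := fun h => hv ⟨he, h⟩
        induction e using Sym2.ind with
        | _ x y =>
        simp only [Sym2.mem_iff, not_or] at hv
        refine ⟨s(⟨x, Ne.symm hv.1⟩, ⟨y, Ne.symm hv.2⟩), ⟨?_, x, y, he, hfw _ _, hfw _ _⟩, rfl⟩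
        exact fun h => SimpleGraph.Adj.ne he (congrArg Subtype.val h)
      · have hwv' : H.Adj v w := hwv
        refine ⟨s(⟨u, huv.ne⟩, ⟨w, hwv'.ne.symm⟩), ⟨?_, v, w, hwv', hfv, hfw _ _⟩, rfl⟩
        exact fun h => hne (congrArg Subtype.val h).symm
    have hdisj : Disjoint (H.edgeSet \ H.incidenceSet v) ((fun w => s(u, w)) '' N) := by
      rw [Set.disjoint_left]
      rintro e ⟨he, -⟩ ⟨w, ⟨⟨-, hwu⟩, -⟩, rfl⟩
      exact hwu he
    have hinj : Function.Injective (fun w => s(u, w)) := fun a b h => Sym2.congr_right.1 h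
    have h2 := (Set.ncard_le_ncard h1 (Set.toFinite _)).trans (Set.ncard_image_le (Set.toFinite _))
    rw [Set.ncard_union_eq hdisj (Set.toFinite _) (Set.toFinite _),
      Set.ncard_image_of_injective _ hinj] at h2
    have h3 : H.edgeSet.ncard ≤ (H.edgeSet \ H.incidenceSet v).ncard + (H.neighborSet v).ncard := by
      rw [← ncard_incidenceSet]
      refine (Set.ncard_le_ncard ?_ (Set.toFinite _)).trans (Set.ncard_union_le _ _)
      intro e he
      by_cases h : e ∈ H.incidenceSet v
      · exact Or.inr h
      · exact Or.inl ⟨he, h⟩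
    have h4 : (H.neighborSet v).ncard ≤
        N.ncard + 1 + (H.neighborSet v ∩ H.neighborSet u).ncard := by
      have hsub : H.neighborSet v ⊆ N ∪ {u} ∪ (H.neighborSet v ∩ H.neighborSet u) := by
        intro w hw
        by_cases h : w ∈ H.neighborSet u
        · exact Or.inr ⟨hw, h⟩
        · by_cases h' : w = u
          · exact Or.inl (Or.inr h')
          · exact Or.inl (Or.inl ⟨⟨hw, h⟩, h'⟩)
      refine (Set.ncard_le_ncard hsub (Set.toFinite _)).trans ((Set.ncard_union_le _ _).trans ?_)
      refine Nat.add_le_add_right ((Set.ncard_union_le _ _).trans ?_) _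
      rw [Set.ncard_singleton]
    omega

/-- In a graph whose degrees are at least half of its order, some `k` vertices pairwise have
many common neighbours. -/
lemma exists_finset_common_neighbors (G : SimpleGraph W) {k : ℕ}
    (hk : k ^ 2 ≤ Fintype.card W) (hG : ∀ w, Fintype.card W ≤ 2 * (G.neighborSet w).ncard) :
    ∃ S : Finset W, S.card = k ∧ ∀ a ∈ S, ∀ b ∈ S, a ≠ b →
      Fintype.card W ≤ 6 * (G.neighborSet a ∩ G.neighborSet b).ncard := by
  classical
  let bad : W → W → Prop := fun a b =>
    a ≠ b ∧ 6 * (G.neighborSet a ∩ G.neighborSet b).ncard < Fintype.card W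
  have hsymm : ∀ a b, bad a b → bad b a := fun a b h =>
    ⟨h.1.symm, by rw [Set.inter_comm]; exact h.2⟩
  -- Bad pairs form no triangle: by inclusion-exclusion, the pairwise intersections of three sets of
  -- at least half the order sum to at least half the order, so one has at least a sixth.
  have htri : ∀ a b c, bad a b → bad a c → ¬ bad b c := by
    rintro a b c ⟨-, hab⟩ ⟨-, hac⟩ ⟨-, hbc⟩
    set A := G.neighborSet a
    set B := G.neighborSet b
    set C := G.neighborSet c
    have h1 := Set.ncard_union_add_ncard_inter A B (Set.toFinite _) (Set.toFinite _)
    have h2 := Set.ncard_union_add_ncard_inter (A ∪ B) C (Set.toFinite _) (Set.toFinite _)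
    have h3 : ((A ∪ B) ∩ C).ncard ≤ (A ∩ C).ncard + (B ∩ C).ncard := by
      rw [Set.union_inter_distrib_right]
      exact Set.ncard_union_le _ _
    have h4 : (A ∪ B ∪ C).ncard ≤ Fintype.card W := by
      rw [← Nat.card_eq_fintype_card]
      exact Set.ncard_le_card _
    have h5 : _ ≤ 2 * A.ncard := hG a
    have h6 : _ ≤ 2 * B.ncard := hG b
    have h7 : _ ≤ 2 * C.ncard := hG c
    omega
  suffices h : ∃ S : Finset W, k ≤ S.card ∧ ∀ a ∈ S, ∀ b ∈ S, ¬ bad a b by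
    obtain ⟨S, hS, hbad⟩ := h
    obtain ⟨T, hTS, hT⟩ := Finset.exists_subset_card_eq hS
    refine ⟨T, hT, fun a ha b hb hab => ?_⟩
    by_contra hlt
    exact hbad a (hTS ha) b (hTS hb) ⟨hab, not_le.1 hlt⟩
  -- Many bad partners of one vertex are themselves free of bad pairs. Otherwise a maximum set `I`
  -- without bad pairs, together with its bad partners, covers everything, which forces `I` to have
  -- k elements.
  by_cases hbig : ∃ a, k ≤ (Finset.univ.filter (bad a)).card
  · obtain ⟨a, ha⟩ := hbig
    refine ⟨_, ha, fun b hb c hc => ?_⟩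
    exact htri a b c (by simpa using hb) (by simpa using hc)
  push Not at hbig
  obtain ⟨I, hI, hmax⟩ := Finset.exists_max_image
    (Finset.univ.filter fun S : Finset W => ∀ a ∈ S, ∀ b ∈ S, ¬ bad a b) Finset.card
    ⟨∅, by simp⟩
  simp only [Finset.mem_filter, Finset.mem_univ, true_and] at hI hmax
  refine ⟨I, ?_, hI⟩
  by_contra hlt
  have hcover : (Finset.univ : Finset W) ⊆ I ∪ I.biUnion fun a => Finset.univ.filter (bad a) := by
    intro w _
    by_contra hw
    simp only [Finset.mem_union, Finset.mem_biUnion, Finset.mem_filter, Finset.mem_univ, true_and,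
      not_or, not_exists, not_and] at hw
    have h1 := hmax (insert w I) (by
      intro a ha b hb
      rcases Finset.mem_insert.1 ha with rfl | ha' <;>
        rcases Finset.mem_insert.1 hb with rfl | hb'
      · exact fun h => h.1 rfl
      · exact fun h => hw.2 b hb' (hsymm _ _ h)
      · exact hw.2 a ha'
      · exact hI a ha' b hb')
    rw [Finset.card_insert_of_notMem hw.1] at h1
    omega
  have h1 := Finset.card_le_card hcover
  rw [Finset.card_univ] at h1
  have h2 : (I.biUnion fun a => Finset.univ.filter (bad a)).card ≤ I.card * (k - 1) :=
    Finset.card_biUnion_le_card_mul _ _ _ fun a _ => Nat.le_sub_one_of_lt (hbig a)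
  have h3 := Finset.card_union_le I (I.biUnion fun a => Finset.univ.filter (bad a))
  obtain ⟨j, rfl⟩ : ∃ j, k = j + 1 := ⟨k - 1, by omega⟩
  have h4 : I.card ≤ j := by omega
  simp only [Nat.add_sub_cancel] at h2
  nlinarith

/-- Each ordered pair of the k centres receives its own common neighbour as connector, which joins
the branch set of the first centre. At least 2k² common neighbours exist, of which at most k ≤ k²
are centres; the k² left outnumber the pairs, so Hall's condition is immediate. -/
lemma hasModel_top_of_dense (G : SimpleGraph W) {k : ℕ}
    (hk : 12 * k ^ 2 ≤ Fintype.card W) (hG : ∀ w, Fintype.card W ≤ 2 * (G.neighborSet w).ncard) :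
    HasModel (⊤ : SimpleGraph (Fin k)) G := by
  classical
  obtain ⟨S, hSk, hS⟩ := exists_finset_common_neighbors G (k := k) (by omega) hG
  let f : Fin k ≃ S := (S.equivFinOfCardEq hSk).symm
  let ι := {q : Fin k × Fin k // q.1 ≠ q.2}
  let t : ι → Finset W := fun q =>
    (G.neighborSet (f q.1.1) ∩ G.neighborSet (f q.1.2)).toFinset \ S
  have ht : ∀ q, k ^ 2 ≤ (t q).card := by
    intro q
    have h1 := hS _ (f q.1.1).2 _ (f q.1.2).2
      (fun h => q.2 (f.injective (Subtype.ext h)))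
    rw [Set.ncard_eq_toFinset_card'] at h1
    have h2 := Finset.le_card_sdiff S
      (G.neighborSet (f q.1.1) ∩ G.neighborSet (f q.1.2)).toFinset
    rw [hSk] at h2
    have h3 : k ≤ k ^ 2 := Nat.le_self_pow two_ne_zero k
    simp only [t]
    omega
  obtain ⟨c, hcinj, hc⟩ := (Finset.all_card_le_biUnion_card_iff_exists_injective t).1 (by
    intro s
    rcases s.eq_empty_or_nonempty with rfl | ⟨q, hq⟩
    · simp
    · have h1 : s.card ≤ k ^ 2 := by
        refine (Finset.card_le_univ s).trans ((Fintype.card_subtype_le _).trans ?_)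
        simp [sq]
      exact (h1.trans (ht q)).trans (Finset.card_le_card (Finset.subset_biUnion_of_mem t hq)))
  have hcS : ∀ q i, c q ≠ f i := by
    intro q i h
    have h1 := hc q
    simp only [t, Finset.mem_sdiff] at h1
    exact h1.2 (h ▸ (f i).2)
  have hcadj : ∀ q, G.Adj (f q.1.1) (c q) ∧ G.Adj (f q.1.2) (c q) := by
    intro q
    have h1 := hc q
    simp only [t, Finset.mem_sdiff, Set.mem_toFinset] at h1
    exact h1.1
  obtain ⟨p, hp⟩ := exists_partial_map
    (S := fun (w : W) (i : Fin k) => w = f i ∨ ∃ q : ι, q.1.1 = i ∧ w = c q) (by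
      rintro w i j (rfl | ⟨q, rfl, rfl⟩) (h | ⟨q', rfl, h⟩)
      · exact f.injective (Subtype.ext h)
      · exact absurd h.symm (hcS _ _)
      · exact absurd h (hcS _ _)
      · rw [hcinj h])
  refine ⟨p, fun i => ⟨f i, (hp _ _).2 (Or.inl rfl)⟩, ?_, ?_⟩
  · have key : ∀ i w, p w = some i →
        ReflTransGen (fun a b => G.Adj a b ∧ p a = some i ∧ p b = some i) w (f i) ∧
        ReflTransGen (fun a b => G.Adj a b ∧ p a = some i ∧ p b = some i) (f i) w := by
      intro i w hw
      have hfi : p (f i) = some i := (hp _ _).2 (Or.inl rfl)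
      rcases (hp _ _).1 hw with rfl | ⟨q, rfl, rfl⟩
      · exact ⟨.refl, .refl⟩
      · exact ⟨.single ⟨(hcadj q).1.symm, hw, hfi⟩, .single ⟨(hcadj q).1, hfi, hw⟩⟩
    exact fun i u v hu hv => (key i u hu).1.trans (key i v hv).2
  · intro i j hij
    exact ⟨c ⟨(i, j), hij⟩, f j, (hp _ _).2 (Or.inr ⟨_, rfl, rfl⟩), (hp _ _).2 (Or.inl rfl),
      (hcadj ⟨(i, j), hij⟩).2.symm⟩

end EdgeDensity

/-- A finite graph of order `n` with at least `m * n` edges contains a complete graph on `k`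
vertices as a minor whenever `m ≥ 12 * k ^ 2`. -/
theorem hasModel_top_of_mul_card_le {k m : ℕ} (hk : 12 * k ^ 2 ≤ m) (hm : 0 < m) {W : Type u}
    [Fintype W] (H : SimpleGraph W) (hW : 0 < Fintype.card W)
    (he : m * Fintype.card W ≤ H.edgeSet.ncard) : HasModel (⊤ : SimpleGraph (Fin k)) H := by
  classical
  induction hn : Fintype.card W using Nat.strong_induction_on generalizing W with
  | _ n ih =>
  -- Surplus edges are dropped so that the average degree is exactly 2m, as needed to find a vertex
  -- of degree at most 2m below.
  wlog hB : H.edgeSet.ncard = m * Fintype.card W generalizing H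
  · obtain ⟨S, hSH, hS⟩ := Set.exists_subset_card_eq he
    have h1 : (SimpleGraph.fromEdgeSet S).edgeSet = S := by
      rw [SimpleGraph.edgeSet_fromEdgeSet, sdiff_eq_left]
      exact Set.disjoint_left.2 fun e h h' => H.not_isDiag_of_mem_edgeSet (hSH h) h'
    have h2 : HasModel (SimpleGraph.fromEdgeSet S) H :=
      HasModel.of_embedding (Function.Embedding.refl _) fun a b h => by
        have h3 : s(a, b) ∈ (SimpleGraph.fromEdgeSet S).edgeSet := h
        rw [h1] at h3
        exact hSH h3
    exact (this (SimpleGraph.fromEdgeSet S) (by rw [h1, hS]) (by rw [h1, hS])).trans h2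
  have hcard : ∀ v : W, Fintype.card {w // w ≠ v} = Fintype.card W - 1 := fun v => by simp
  have hmW : m * (Fintype.card W - 1) + m = m * Fintype.card W := by
    obtain ⟨j, hj⟩ : ∃ j, Fintype.card W = j + 1 := ⟨_, (Nat.succ_pred_eq_of_pos hW).symm⟩
    rw [hj]; simp [mul_add]
  have hpos : 0 < H.edgeSet.ncard := lt_of_lt_of_le (Nat.mul_pos hm hW) he
  obtain ⟨e, heH⟩ := Set.nonempty_of_ncard_ne_zero hpos.ne'
  have hW2 : 1 < Fintype.card W := by
    induction e using Sym2.ind with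
    | _ x y => exact Fintype.one_lt_card_iff.2 ⟨x, y, SimpleGraph.Adj.ne heH⟩
  by_cases hA : ∃ v, (H.neighborSet v).ncard ≤ m
  · obtain ⟨v, hv⟩ := hA
    obtain ⟨H', hH', hcount⟩ := exists_hasModel_deleteVertex H v
    exact (ih _ (by rw [← hn, hcard]; omega) H' (by rw [hcard]; omega)
      (by rw [hcard]; omega) rfl).trans hH'
  -- Like the deletion above, this contraction loses one vertex and at most m edges, so the density
  -- hypothesis persists.
  by_cases hC : ∃ u v, H.Adj u v ∧ (H.neighborSet v ∩ H.neighborSet u).ncard < m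
  · obtain ⟨u, v, huv, hlt⟩ := hC
    obtain ⟨H', hH', hcount⟩ := exists_hasModel_contract H huv
    exact (ih _ (by rw [← hn, hcard]; omega) H' (by rw [hcard]; omega)
      (by rw [hcard]; omega) rfl).trans hH'
  push Not at hA hC
  -- The neighbourhood of `v` has more than m and at most 2m vertices, and each of them has at least
  -- m neighbours inside it, hence at least half of its order.
  obtain ⟨v, -, hv⟩ : ∃ v ∈ (Finset.univ : Finset W), (H.neighborSet v).ncard ≤ 2 * m := by
    refine Finset.exists_le_of_sum_le (Finset.card_pos.1 (by simpa using hW)) ?_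
    rw [sum_ncard_neighborSet, Finset.sum_const, Finset.card_univ, smul_eq_mul]
    nlinarith
  have hcardN : Fintype.card (H.neighborSet v) = (H.neighborSet v).ncard := by
    rw [Set.ncard_eq_toFinset_card', Set.toFinset_card]
  refine HasModel.trans (hasModel_top_of_dense (H.comap (Subtype.val : H.neighborSet v → W))
    (by rw [hcardN]; exact hk.trans (hA v).le) ?_)
    (HasModel.of_embedding (Function.Embedding.subtype _) fun a b h => h)
  intro w
  have h1 := hC w.1 v w.2.symm
  have h2 : Subtype.val '' ((H.comap (Subtype.val : H.neighborSet v → W)).neighborSet w) =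
      H.neighborSet v ∩ H.neighborSet w := by
    ext x
    simp [SimpleGraph.mem_neighborSet, and_comm]
  rw [← h2, Set.ncard_image_of_injective _ Subtype.val_injective] at h1
  rw [hcardN]
  omega

/-- A finite graph of minimum degree at least `24 * k ^ 2` contains a complete graph on `k`
vertices as a minor. -/
theorem hasModel_top_of_le_degree {k : ℕ} (hk : 0 < k) {W : Type u} [Fintype W] [Nonempty W]
    (H : SimpleGraph W) (hH : ∀ w, 24 * k ^ 2 ≤ (H.neighborSet w).ncard) :
    HasModel (⊤ : SimpleGraph (Fin k)) H := by
  refine hasModel_top_of_mul_card_le (m := 12 * k ^ 2) le_rfl (by positivity) H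
    Fintype.card_pos ?_
  have h1 : ∑ _w : W, 24 * k ^ 2 ≤ ∑ w, (H.neighborSet w).ncard :=
    Finset.sum_le_sum fun w _ => hH w
  rw [sum_ncard_neighborSet, Finset.sum_const, Finset.card_univ, smul_eq_mul] at h1
  nlinarith

/-! ### Voronoi cells and the sparsity forced by large θ_r-girth. -/

section Voronoi

variable {V : Type u}

/-- A spanning forest of `Γ` by trees of height at most `2 * R`, each of which contains the ball of
radius `R` around its root. -/
structure VoronoiForest (Γ : SimpleGraph V) (R : ℕ) where
  level : V → ℕ
  parent : V → V
  root : V → V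
  level_le : ∀ v, level v ≤ 2 * R
  adj_parent : ∀ v, 0 < level v → Γ.Adj v (parent v)
  level_parent : ∀ v, 0 < level v → level (parent v) + 1 = level v
  root_parent : ∀ v, 0 < level v → root (parent v) = root v
  root_of_level : ∀ v, level v = 0 → root v = v
  level_root : ∀ v, level (root v) = 0
  level_adj : ∀ u w, Γ.Adj u w → level w ≤ level u + 1
  root_adj : ∀ u w, Γ.Adj u w → level u < R → root w = root u

lemma exists_maximal_separated [Finite V] (Γ : SimpleGraph V) (N : ℕ) :
    ∃ C : Set V, (∀ a ∈ C, ∀ b ∈ C, ∀ w : Γ.Walk a b, w.length ≤ N → a = b) ∧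
      ∀ v, ∃ c ∈ C, ∃ w : Γ.Walk v c, w.length ≤ N := by
  obtain ⟨C, hC⟩ := Set.Finite.exists_maximal
    (s := {C : Set V | ∀ a ∈ C, ∀ b ∈ C, ∀ w : Γ.Walk a b, w.length ≤ N → a = b})
    (Set.toFinite _) ⟨∅, by simp⟩
  refine ⟨C, hC.prop, fun v => ?_⟩
  by_contra hv
  push Not at hv
  have h : insert v C ∈
      {C : Set V | ∀ a ∈ C, ∀ b ∈ C, ∀ w : Γ.Walk a b, w.length ≤ N → a = b} := by
    rintro a (rfl | ha) b (rfl | hb) w hw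
    · rfl
    · exact absurd hw (not_le.2 (hv b hb w))
    · exact absurd hw (not_le.2 (by simpa using hv a ha w.reverse))
    · exact hC.prop a ha b hb w hw
  have hvC : v ∈ C := hC.le_of_ge h (Set.subset_insert _ _) (Set.mem_insert _ _)
  exact absurd (hv v hvC SimpleGraph.Walk.nil) (by simp)

/-- The level is the distance to a maximal set of centres with pairwise distances above 2R; by
maximality it never exceeds 2R. -/
lemma exists_voronoiForest [Finite V] (Γ : SimpleGraph V) (R : ℕ) :
    Nonempty (VoronoiForest Γ R) := by
  classical
  obtain ⟨C, hsep, hcov⟩ := exists_maximal_separated Γ (2 * R)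
  have hex : ∀ v, ∃ n, ∃ c ∈ C, ∃ w : Γ.Walk v c, w.length = n := fun v => by
    obtain ⟨c, hc, w, -⟩ := hcov v
    exact ⟨_, c, hc, w, rfl⟩
  let level : V → ℕ := fun v => Nat.find (hex v)
  have hspec : ∀ v, ∃ c ∈ C, ∃ w : Γ.Walk v c, w.length = level v := fun v => Nat.find_spec (hex v)
  have hmin : ∀ v c, c ∈ C → ∀ w : Γ.Walk v c, level v ≤ w.length := fun v c hc w =>
    Nat.find_min' (hex v) ⟨c, hc, w, rfl⟩
  have hadj : ∀ u w, Γ.Adj u w → level w ≤ level u + 1 := by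
    intro u w h
    obtain ⟨c, hc, p, hp⟩ := hspec u
    have := hmin w c hc (SimpleGraph.Walk.cons h.symm p)
    rwa [SimpleGraph.Walk.length_cons, hp] at this
  have hpar : ∀ v, ∃ u, 0 < level v → Γ.Adj v u ∧ level u + 1 = level v := by
    intro v
    by_cases hv : 0 < level v
    · obtain ⟨c, hc, p, hp⟩ := hspec v
      cases p with
      | nil => simp at hp; omega
      | @cons _ u _ h p =>
        rw [SimpleGraph.Walk.length_cons] at hp
        have h1 := hmin u c hc p
        have h2 := hadj u v h.symm
        exact ⟨u, fun _ => ⟨h, by omega⟩⟩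
    · exact ⟨v, fun h => absurd h hv⟩
  choose parent hparent using hpar
  -- Nearest centres need not be unique; following parents makes the choice consistent along tree
  -- paths.
  let root : V → V := fun v => parent^[level v] v
  have hroot0 : ∀ v, level v = 0 → root v = v := fun v hv => by simp [root, hv]
  have hrootp : ∀ v, 0 < level v → root (parent v) = root v := by
    intro v hv
    simp only [root]
    rw [← (hparent v hv).2, Function.iterate_succ_apply]
  have hlevel0 : ∀ v, level v = 0 → v ∈ C := by
    intro v hv
    obtain ⟨c, hc, p, hp⟩ := hspec v
    rw [hv] at hp
    exact (SimpleGraph.Walk.eq_of_length_eq_zero hp) ▸ hc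
  have hwalk : ∀ n v, level v = n → level (root v) = 0 ∧ ∃ w : Γ.Walk v (root v), w.length = n := by
    intro n
    induction n with
    | zero =>
      intro v hv
      rw [hroot0 v hv]
      exact ⟨hv, SimpleGraph.Walk.nil, rfl⟩
    | succ n ih =>
      intro v hv
      have hpos : 0 < level v := by omega
      have hp := hparent v hpos
      obtain ⟨h1, w, hw⟩ := ih (parent v) (by omega)
      rw [← hrootp v hpos]
      exact ⟨h1, SimpleGraph.Walk.cons hp.1 w, by rw [SimpleGraph.Walk.length_cons, hw]⟩
  refine ⟨⟨level, parent, root, ?_, fun v hv => (hparent v hv).1, fun v hv => (hparent v hv).2,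
    hrootp, hroot0, fun v => (hwalk _ v rfl).1, hadj, ?_⟩⟩
  · intro v
    obtain ⟨c, hc, w, hw⟩ := hcov v
    exact (hmin v c hc w).trans hw
  -- Through the edge uw the two roots are joined by a walk of length level u + 1 + level w ≤ 2 *
  -- level u + 2 ≤ 2R, so separation identifies them.
  · intro u w huw hu
    obtain ⟨h1, p, hp⟩ := hwalk _ u rfl
    obtain ⟨h2, q, hq⟩ := hwalk _ w rfl
    have h3 := hadj u w huw
    refine hsep _ (hlevel0 _ h2) _ (hlevel0 _ h1)
      (q.reverse.append (SimpleGraph.Walk.cons huw.symm p)) ?_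
    rw [SimpleGraph.Walk.length_append, SimpleGraph.Walk.length_reverse,
      SimpleGraph.Walk.length_cons]
    omega

namespace VoronoiForest

variable {Γ : SimpleGraph V} {R : ℕ} (T : VoronoiForest Γ R)

lemma level_iterate {v : V} {j : ℕ} (hj : j ≤ T.level v) :
    T.level (T.parent^[j] v) + j = T.level v ∧ T.root (T.parent^[j] v) = T.root v := by
  induction j with
  | zero => simp
  | succ j ih =>
    obtain ⟨h1, h2⟩ := ih (by omega)
    have hpos : 0 < T.level (T.parent^[j] v) := by omega
    rw [Function.iterate_succ_apply', T.root_parent _ hpos, h2]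
    have := T.level_parent _ hpos
    exact ⟨by omega, rfl⟩

lemma iterate_level (v : V) : T.parent^[T.level v] v = T.root v := by
  obtain ⟨h1, h2⟩ := T.level_iterate (le_refl (T.level v))
  rw [← h2, T.root_of_level _ (by omega)]

/-- The vertices on the tree path from `v` to its root. -/
def ancestors (v : V) : Set V := {x | ∃ j ≤ T.level v, T.parent^[j] v = x}

lemma root_of_mem_ancestors {v x : V} (h : x ∈ T.ancestors v) : T.root x = T.root v := by
  obtain ⟨j, hj, rfl⟩ := h
  exact (T.level_iterate hj).2

lemma level_lt_of_mem_ancestors {v x : V} (h : x ∈ T.ancestors v) (hne : x ≠ v) :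
    T.level x < T.level v := by
  obtain ⟨j, hj, rfl⟩ := h
  have h1 := (T.level_iterate hj).1
  have : j ≠ 0 := by rintro rfl; exact hne rfl
  omega

lemma self_mem_ancestors (v : V) : v ∈ T.ancestors v := ⟨0, Nat.zero_le _, rfl⟩

variable [DecidableEq V]

/-- The edges on the tree path from `v` to its root. -/
def pathEdges (v : V) : Finset (Sym2 V) :=
  (Finset.range (T.level v)).image fun j => s(T.parent^[j] v, T.parent^[j + 1] v)

lemma card_pathEdges_le (v : V) : (T.pathEdges v).card ≤ 2 * R :=
  Finset.card_image_le.trans (by rw [Finset.card_range]; exact T.level_le v)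

lemma pathEdges_subset (v : V) : ↑(T.pathEdges v) ⊆ Γ.edgeSet := by
  intro e he
  simp only [pathEdges, Finset.coe_image, Set.mem_image, Finset.coe_range, Set.mem_Iio] at he
  obtain ⟨j, hj, rfl⟩ := he
  rw [Function.iterate_succ_apply']
  have h := (T.level_iterate hj.le).1
  have hpos : 0 < T.level (T.parent^[j] v) := by omega
  exact T.adj_parent _ hpos

/-- All these tree paths end in the common root c. -/
lemma connectedBy_ancestors {X : Finset V} {c : V} (hX : ∀ v ∈ X, T.root v = c) :
    ConnectedBy (X.biUnion T.pathEdges) (⋃ v ∈ X, T.ancestors v) := by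
  set A : Set V := ⋃ v ∈ X, T.ancestors v
  set S : V → V → Prop := fun x y => s(x, y) ∈ X.biUnion T.pathEdges ∧ x ∈ A ∧ y ∈ A with hS
  have hsymm : Std.Symm S := ⟨fun x y h => ⟨by rw [Sym2.eq_swap]; exact h.1, h.2.2, h.2.1⟩⟩
  have hanc : ∀ v ∈ X, ∀ j ≤ T.level v, T.parent^[j] v ∈ A := fun v hv j hj =>
    Set.mem_biUnion hv ⟨j, hj, rfl⟩
  have key : ∀ v ∈ X, ∀ i j, j + i = T.level v → ReflTransGen S (T.parent^[j] v) c := by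
    intro v hv i
    induction i with
    | zero =>
      intro j hj
      rw [← hX v hv, ← T.iterate_level v, ← hj, Nat.add_zero]
    | succ i ih =>
      intro j hj
      refine ReflTransGen.head ⟨?_, hanc v hv j (by omega), hanc v hv (j + 1) (by omega)⟩
        (ih (j + 1) (by omega))
      exact Finset.mem_biUnion.2 ⟨v, hv, Finset.mem_image.2
        ⟨j, Finset.mem_range.2 (by omega), rfl⟩⟩
  have key' : ∀ a ∈ A, ReflTransGen S a c := by
    intro a ha
    obtain ⟨v, hv, j, hj, rfl⟩ := Set.mem_iUnion₂.1 ha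
    exact key v hv (T.level v - j) j (by omega)
  intro a ha b hb
  exact (key' a ha).trans (symm (key' b hb))

lemma card_biUnion_pathEdges_le {X : Finset V} {n : ℕ} (hX : X.card ≤ n) :
    (X.biUnion T.pathEdges).card ≤ n * (2 * R) :=
  (Finset.card_biUnion_le_card_mul _ _ _ fun v _ => T.card_pathEdges_le v).trans
    (Nat.mul_le_mul_right _ hX)

lemma biUnion_pathEdges_subset (X : Finset V) : ↑(X.biUnion T.pathEdges) ⊆ Γ.edgeSet := by
  intro e he
  obtain ⟨v, -, hv⟩ := Finset.mem_biUnion.1 (Finset.mem_coe.1 he)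
  exact T.pathEdges_subset v hv

end VoronoiForest

/-- Every pair of disjoint connected sets joined by `r` edges uses at least `z` edges in total. -/
def ThetaSparse (Γ : SimpleGraph V) (r z : ℕ) : Prop :=
  ∀ ⦃A B : Set V⦄, Disjoint A B → ∀ ⦃P Q : Finset (Sym2 V)⦄, ConnectedBy P A → ConnectedBy Q B →
    ↑P ⊆ Γ.edgeSet → ↑Q ⊆ Γ.edgeSet → ∀ F : Finset (V × V), F.card = r →
    (∀ e ∈ F, e.1 ∈ A ∧ e.2 ∈ B ∧ Γ.Adj e.1 e.2) → z ≤ P.card + Q.card + r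

namespace VoronoiForest

variable [Fintype V] {Γ : SimpleGraph V} {R r z : ℕ} (T : VoronoiForest Γ R)

open Classical in
-- Levels drop along tree paths, so the paths from neighbours no higher than u avoid u. With r such
-- neighbours, the paths and {u} would form a θ_r-model with at most r * 2R + r edges.
lemma card_low_neighbors_lt (hΓ : ThetaSparse Γ r z) (hz : r * (4 * R + 1) < z) (u : V) :
    (Finset.univ.filter fun w => Γ.Adj u w ∧ T.root w = T.root u ∧ T.level w ≤ T.level u).card
      < r := by
  by_contra hlt
  obtain ⟨X, hXs, hX⟩ := Finset.exists_subset_card_eq (not_lt.1 hlt)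
  have hX' : ∀ w ∈ X, Γ.Adj u w ∧ T.root w = T.root u ∧ T.level w ≤ T.level u :=
    fun w hw => by simpa using hXs hw
  have hdisj : Disjoint (⋃ v ∈ X, T.ancestors v) {u} := by
    rw [Set.disjoint_singleton_right]
    intro hu
    obtain ⟨v, hv, huv⟩ := Set.mem_iUnion₂.1 hu
    have h1 := hX' v hv
    exact absurd (T.level_lt_of_mem_ancestors huv h1.1.ne) (not_lt.2 h1.2.2)
  have hsing : ConnectedBy (∅ : Finset (Sym2 V)) {u} := by
    rintro a rfl b rfl
    exact .refl
  have h := hΓ hdisj (T.connectedBy_ancestors fun v hv => (hX' v hv).2.1) hsing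
    (T.biUnion_pathEdges_subset X) (by simp) (X.image fun w => (w, u))
    (by rw [Finset.card_image_of_injective _ (fun a b h => (Prod.ext_iff.1 h).1), hX]) (by
      intro e he
      obtain ⟨w, hw, rfl⟩ := Finset.mem_image.1 he
      exact ⟨Set.mem_biUnion hw (T.self_mem_ancestors w), rfl, (hX' w hw).1.symm⟩)
  have h2 := T.card_biUnion_pathEdges_le hX.le
  rw [Finset.card_empty] at h
  nlinarith

open Classical in
-- Tree paths in different cells are disjoint. With r edges between the cells, both families of
-- paths give a model with at most 2 * (r * 2R) + r = r * (4R + 1) edges, the source of the bound on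
-- R.
lemma card_edges_between_lt (hΓ : ThetaSparse Γ r z) (hz : r * (4 * R + 1) < z) {c c' : V}
    (hc : c ≠ c') :
    (Finset.univ.filter fun e : V × V => Γ.Adj e.1 e.2 ∧ T.root e.1 = c ∧ T.root e.2 = c').card
      < r := by
  by_contra hlt
  obtain ⟨F, hFs, hF⟩ := Finset.exists_subset_card_eq (not_lt.1 hlt)
  have hF' : ∀ e ∈ F, Γ.Adj e.1 e.2 ∧ T.root e.1 = c ∧ T.root e.2 = c' :=
    fun w hw => by simpa using hFs hw
  have hX : ∀ v ∈ F.image Prod.fst, T.root v = c := by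
    intro v hv
    obtain ⟨e, he, rfl⟩ := Finset.mem_image.1 hv
    exact (hF' e he).2.1
  have hY : ∀ v ∈ F.image Prod.snd, T.root v = c' := by
    intro v hv
    obtain ⟨e, he, rfl⟩ := Finset.mem_image.1 hv
    exact (hF' e he).2.2
  have hdisj : Disjoint (⋃ v ∈ F.image Prod.fst, T.ancestors v)
      (⋃ v ∈ F.image Prod.snd, T.ancestors v) := by
    rw [Set.disjoint_left]
    intro x hx hx'
    obtain ⟨v, hv, hxv⟩ := Set.mem_iUnion₂.1 hx
    obtain ⟨w, hw, hxw⟩ := Set.mem_iUnion₂.1 hx'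
    exact hc (by rw [← hX v hv, ← hY w hw, ← T.root_of_mem_ancestors hxv,
      T.root_of_mem_ancestors hxw])
  have h := hΓ hdisj (T.connectedBy_ancestors hX) (T.connectedBy_ancestors hY)
    (T.biUnion_pathEdges_subset _) (T.biUnion_pathEdges_subset _) F hF (by
      intro e he
      exact ⟨Set.mem_biUnion (Finset.mem_image_of_mem _ he) (T.self_mem_ancestors _),
        Set.mem_biUnion (Finset.mem_image_of_mem _ he) (T.self_mem_ancestors _), (hF' e he).1⟩)
  have h2 := T.card_biUnion_pathEdges_le
    (Finset.card_image_le.trans hF.le : (F.image Prod.fst).card ≤ r)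
  have h3 := T.card_biUnion_pathEdges_le
    (Finset.card_image_le.trans hF.le : (F.image Prod.snd).card ≤ r)
  nlinarith

end VoronoiForest

end Voronoi

/-! ### Minimum degree after contracting the cells. -/

section Quotient

namespace VoronoiForest

variable {V : Type u} {Γ : SimpleGraph V} {R : ℕ} (T : VoronoiForest Γ R)

/-- The graph obtained by contracting every tree of the forest to its root. -/
def quotient : SimpleGraph {c : V // T.root c = c} where
  Adj c c' := c ≠ c' ∧ ∃ u v, T.root u = c ∧ T.root v = c' ∧ Γ.Adj u v
  symm := ⟨fun _ _ ⟨h, u, v, hu, hv, huv⟩ => ⟨h.symm, v, u, hv, hu, huv.symm⟩⟩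
  loopless := ⟨fun _ h => h.1 rfl⟩

lemma root_root (v : V) : T.root (T.root v) = T.root v := T.root_of_level _ (T.level_root v)

lemma hasModel_quotient : HasModel T.quotient Γ := by
  have hp : ∀ v (c : {c : V // T.root c = c}),
      some (⟨T.root v, T.root_root v⟩ : {c : V // T.root c = c}) = some c ↔ T.root v = c := by
    intro v c
    rw [Option.some_inj, Subtype.ext_iff]
  refine ⟨fun v => some ⟨T.root v, T.root_root v⟩, ?_, ?_, ?_⟩
  · exact fun c => ⟨c, (hp _ _).2 c.2⟩
  · simp only [hp]
    intro c
    have hsymm : Std.Symm (fun a b => Γ.Adj a b ∧ T.root a = c ∧ T.root b = c) :=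
      ⟨fun x y h => ⟨h.1.symm, h.2.2, h.2.1⟩⟩
    have key : ∀ n v, T.level v = n → T.root v = c →
        ReflTransGen (fun a b => Γ.Adj a b ∧ T.root a = c ∧ T.root b = c) v c := by
      intro n
      induction n with
      | zero =>
        intro v hv hc
        rw [← hc, T.root_of_level v hv]
      | succ n ih =>
        intro v hv hc
        have hpos : 0 < T.level v := by omega
        have h1 := T.level_parent v hpos
        have h2 := T.root_parent v hpos
        exact ReflTransGen.head ⟨T.adj_parent v hpos, hc, h2.trans hc⟩
          (ih _ (by omega) (h2.trans hc))
    intro a b ha hb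
    exact (key _ a rfl ha).trans (symm (key _ b rfl hb))
  · rintro c c' ⟨-, u, v, hu, hv, huv⟩
    exact ⟨u, v, (hp _ _).2 hu, (hp _ _).2 hv, huv⟩

variable [Fintype V]

open Classical in
-- Double counting between consecutive levels, with r = s + 1. Below level R all neighbours stay in
-- the cell and at most s are not one level up; conversely, a vertex has at most s neighbours one
-- level down.
lemma mul_card_level_le {s d z : ℕ} (hΓ : ThetaSparse Γ (s + 1) z)
    (hz : (s + 1) * (4 * R + 1) < z) (hd : ∀ v, d ≤ (Γ.neighborSet v).ncard) (c : V) {i : ℕ}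
    (hi : i < R) :
    (Finset.univ.filter fun v => T.root v = c ∧ T.level v = i).card * (d - s) ≤
      (Finset.univ.filter fun v => T.root v = c ∧ T.level v = i + 1).card * s := by
  refine Finset.card_mul_le_card_mul Γ.Adj ?_ ?_
  · intro u hu
    simp only [Finset.mem_filter, Finset.mem_univ, true_and] at hu
    have hlow := T.card_low_neighbors_lt hΓ hz u
    have hdu := hd u
    rw [Set.ncard_eq_toFinset_card'] at hdu
    have hsub : (Γ.neighborSet u).toFinset ⊆
        Finset.bipartiteAbove Γ.Adj
          (Finset.univ.filter fun v => T.root v = c ∧ T.level v = i + 1) u ∪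
        Finset.univ.filter fun w => Γ.Adj u w ∧ T.root w = T.root u ∧ T.level w ≤ T.level u := by
      intro w hw
      have huw : Γ.Adj u w := by simpa using hw
      have h1 := T.root_adj u w huw (by omega)
      have h2 := T.level_adj u w huw
      simp only [Finset.mem_union, Finset.mem_bipartiteAbove, Finset.mem_filter, Finset.mem_univ,
        true_and]
      by_cases h3 : T.level w ≤ T.level u
      · exact Or.inr ⟨huw, h1, h3⟩
      · exact Or.inl ⟨⟨h1.trans hu.1, by omega⟩, huw⟩
    have h4 := (Finset.card_le_card hsub).trans (Finset.card_union_le _ _)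
    omega
  · intro w hw
    simp only [Finset.mem_filter, Finset.mem_univ, true_and] at hw
    refine (Finset.card_le_card ?_).trans (Nat.lt_succ_iff.1 (T.card_low_neighbors_lt hΓ hz w))
    intro u hu
    simp only [Finset.mem_bipartiteBelow, Finset.mem_filter, Finset.mem_univ, true_and] at hu ⊢
    exact ⟨hu.2.symm, hu.1.1.trans hw.1.symm, by omega⟩

open Classical in
-- The oriented edges starting in the cell are counted. One inside the cell, or its reverse, ends no
-- higher than it starts, giving at most 2s per vertex; at most s of the others go to each adjacent
-- cell.
lemma mul_card_cell_le {s d z : ℕ} (hΓ : ThetaSparse Γ (s + 1) z)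
    (hz : (s + 1) * (4 * R + 1) < z) (hd : ∀ v, d ≤ (Γ.neighborSet v).ncard)
    (c : {c : V // T.root c = c}) :
    d * (Finset.univ.filter fun v => T.root v = c).card ≤
      s * (T.quotient.neighborSet c).ncard +
        2 * (s * (Finset.univ.filter fun v => T.root v = c).card) := by
  set cell := Finset.univ.filter fun v => T.root v = c with hcell
  let all := Finset.univ.filter fun e : V × V => T.root e.1 = c ∧ Γ.Adj e.1 e.2
  let out := Finset.univ.filter fun e : V × V => T.root e.1 = c ∧ Γ.Adj e.1 e.2 ∧ T.root e.2 ≠ c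
  let down := Finset.univ.filter fun e : V × V =>
    T.root e.1 = c ∧ Γ.Adj e.1 e.2 ∧ T.root e.2 = c ∧ T.level e.2 ≤ T.level e.1
  have hall : d * cell.card ≤ all.card := by
    have h := Finset.card_eq_sum_card_fiberwise (f := Prod.fst) (s := all) (t := cell)
      (fun e he => by
        have : T.root e.1 = c ∧ Γ.Adj e.1 e.2 := by simpa [all] using he
        simpa [cell] using this.1)
    rw [h, mul_comm, ← smul_eq_mul]
    refine Finset.card_nsmul_le_sum _ _ _ fun u hu => ?_
    have hu' : T.root u = c := by simpa [cell] using hu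
    refine (hd u).trans ?_
    rw [Set.ncard_eq_toFinset_card']
    refine Finset.card_le_card_of_injOn (fun w => (u, w)) ?_ fun a _ b _ h => (Prod.ext_iff.1 h).2
    intro w hw
    have huw : Γ.Adj u w := by simpa using hw
    simp [all, hu', huw]
  have hdown : down.card ≤ s * cell.card := by
    refine Finset.card_le_mul_card_image_of_maps_to (f := Prod.fst) ?_ s ?_
    · intro e he
      simp only [down, cell, Finset.mem_filter, Finset.mem_univ, true_and] at he ⊢
      exact he.1
    · intro u hu
      have hu' : T.root u = c := by simpa [cell] using hu
      refine le_trans ?_ (Nat.lt_succ_iff.1 (T.card_low_neighbors_lt hΓ hz u))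
      refine Finset.card_le_card_of_injOn Prod.snd ?_ ?_
      · rintro ⟨a, w⟩ he
        simp only [down, Finset.coe_filter, Finset.mem_filter, Finset.mem_univ, true_and,
          Set.mem_ofPred_eq] at he ⊢
        obtain ⟨⟨h1, h2, h3, h4⟩, rfl⟩ := he
        exact ⟨h2, h3.trans h1.symm, h4⟩
      · rintro ⟨a, w⟩ he ⟨b, w'⟩ he' h
        simp only [Finset.coe_filter, Set.mem_ofPred_eq] at he he'
        exact Prod.ext (he.2.trans he'.2.symm) h
  have hout : out.card ≤ s * (T.quotient.neighborSet c).ncard := by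
    rw [Set.ncard_eq_toFinset_card']
    refine Finset.card_le_mul_card_image_of_maps_to
      (f := fun e => (⟨T.root e.2, T.root_root e.2⟩ : {c : V // T.root c = c})) ?_ s ?_
    · intro e he
      have h : T.root e.1 = c ∧ Γ.Adj e.1 e.2 ∧ T.root e.2 ≠ c := by simpa [out] using he
      rw [Set.mem_toFinset]
      exact ⟨fun hc => h.2.2 (congrArg Subtype.val hc).symm, e.1, e.2, h.1, rfl, h.2.1⟩
    · intro c' hc'
      rw [Set.mem_toFinset] at hc'
      have hne : (c : V) ≠ c' := fun h => hc'.1 (Subtype.ext h)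
      refine le_trans (Finset.card_le_card ?_)
        (Nat.lt_succ_iff.1 (T.card_edges_between_lt hΓ hz hne))
      intro e he
      simp only [out, Finset.mem_filter, Finset.mem_univ, true_and] at he ⊢
      exact ⟨he.1.2.1, he.1.1, congrArg Subtype.val he.2⟩
  have hsub : all ⊆ out ∪ (down ∪ down.image Prod.swap) := by
    rintro ⟨u, w⟩ he
    have h : T.root u = c ∧ Γ.Adj u w := by simpa [all] using he
    simp only [Finset.mem_union, Finset.mem_image]
    by_cases hw : T.root w = c
    · right
      rcases le_total (T.level w) (T.level u) with hl | hl
      · exact Or.inl (by simp [down, h, hw, hl])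
      · exact Or.inr ⟨(w, u), by simp [down, h, hw, hl, h.2.symm], rfl⟩
    · exact Or.inl (by simp [out, h, hw])
  have h1 := Finset.card_le_card hsub
  have h2 := Finset.card_union_le out (down ∪ down.image Prod.swap)
  have h3 := Finset.card_union_le down (down.image Prod.swap)
  have h4 : (down.image Prod.swap).card ≤ down.card := Finset.card_image_le
  omega

lemma le_degree_quotient {r d z : ℕ} (hr : 2 ≤ r) (hrd : 3 * r ≤ d) (hΓ : ThetaSparse Γ r z)
    (hz : r * (4 * R + 1) < z) (hd : ∀ v, d ≤ (Γ.neighborSet v).ncard)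
    (c : {c : V // T.root c = c}) :
    (d / r : ℝ) / 3 * ((d / r : ℝ) - 1) ^ R ≤ (T.quotient.neighborSet c).ncard := by
  classical
  -- Fewer than r means at most s; `2 ≤ r` makes s positive, so that it can be cancelled.
  obtain ⟨s, rfl⟩ : ∃ s, r = s + 1 := ⟨r - 1, by omega⟩
  have hs : (1 : ℝ) ≤ s := by exact_mod_cast (by omega : 1 ≤ s)
  have hrd' : 3 * ((s : ℝ) + 1) ≤ d := by exact_mod_cast hrd
  have hr0 : (0 : ℝ) < ((s + 1 : ℕ) : ℝ) := by positivity
  set x : ℝ := (d : ℝ) / ((s + 1 : ℕ) : ℝ) with hx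
  have hdx : (d : ℝ) = x * (s + 1) := by rw [hx]; push_cast; field_simp
  have hx3 : 3 ≤ x := by
    rw [hx, le_div_iff₀ hr0]
    push_cast
    exact hrd'
  have hlev : ∀ i ≤ R, (x - 1) ^ i ≤
      ((Finset.univ.filter fun v => T.root v = c ∧ T.level v = i).card : ℝ) := by
    intro i
    induction i with
    | zero =>
      intro _
      rw [pow_zero]
      have : 0 < (Finset.univ.filter fun v => T.root v = c ∧ T.level v = 0).card := by
        refine Finset.card_pos.2 ⟨c, ?_⟩
        have := T.level_root c
        rw [c.2] at this
        simp [c.2, this]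
      exact_mod_cast this
    | succ i ih =>
      intro hi
      have h1 := ih (by omega)
      have h2 := T.mul_card_level_le hΓ hz hd c (i := i) (by omega)
      set a := (Finset.univ.filter fun v => T.root v = c ∧ T.level v = i).card
      set b := (Finset.univ.filter fun v => T.root v = c ∧ T.level v = i + 1).card
      have h3 : (a : ℝ) * (d - s) ≤ b * s := by
        have : ((d - s : ℕ) : ℝ) = d - s := Nat.cast_sub (by omega)
        rw [← this]
        exact_mod_cast h2
      have h4 : (x - 1) * s ≤ d - s := by rw [hdx]; nlinarith
      have h5 : (x - 1) ^ (i + 1) * s ≤ b * s := by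
        calc (x - 1) ^ (i + 1) * s = (x - 1) ^ i * ((x - 1) * s) := by ring
          _ ≤ a * (d - s) := by
            apply mul_le_mul h1 h4 _ (Nat.cast_nonneg _)
            exact mul_nonneg (by linarith) (by linarith)
          _ ≤ b * s := h3
      exact le_of_mul_le_mul_right h5 (by linarith)
  have hcell := T.mul_card_cell_le hΓ hz hd c
  have hle : (Finset.univ.filter fun v => T.root v = c ∧ T.level v = R).card ≤
      (Finset.univ.filter fun v => T.root v = c).card :=
    Finset.card_le_card fun v hv => by
      simp only [Finset.mem_filter, Finset.mem_univ, true_and] at hv ⊢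
      exact hv.1
  set n := (Finset.univ.filter fun v => T.root v = c).card
  set D := (T.quotient.neighborSet c).ncard
  have h1 : (x - 1) ^ R ≤ (n : ℝ) := (hlev R le_rfl).trans (by exact_mod_cast hle)
  have h2 : (d : ℝ) * n ≤ s * D + 2 * (s * n) := by exact_mod_cast hcell
  have hn : (0 : ℝ) ≤ n := Nat.cast_nonneg _
  -- Since d ≥ x * s, one has d - 2s ≥ (x - 2) * s, and x - 2 ≥ x / 3 because x ≥ 3.
  have h3 : x / 3 * n * s ≤ D * s := by
    rw [hdx] at h2
    have h4 : 0 ≤ (n : ℝ) * s := mul_nonneg hn (by linarith)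
    nlinarith [mul_nonneg h4 (sub_nonneg.2 hx3), mul_nonneg hn (by linarith : (0 : ℝ) ≤ x)]
  have h4 : x / 3 * n ≤ D := le_of_mul_le_mul_right h3 (by linarith)
  exact (mul_le_mul_of_nonneg_left h1 (by linarith)).trans h4

end VoronoiForest

end Quotient

/-! ### Choice of the radius and of the clique order. -/

section Main

/-- A graph of minimum degree at least `d` without small `θ_r`-models contains a complete graph on
`k` vertices as a minor, as long as `72 * k ^ 2` is at most `(d / r) ^ (z / (12 * r))`. -/
lemma hasModel_top_of_thetaSparse {V : Type u} [Fintype V] [Nonempty V] {Γ : SimpleGraph V}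
    {r d z k : ℕ} (hr : 2 ≤ r) (hrd : 3 * r ≤ d) (hz : 2 * r ≤ z) (hΓ : ThetaSparse Γ r z)
    (hd : ∀ v, d ≤ (Γ.neighborSet v).ncard) (hk : 0 < k)
    (hkx : 72 * (k : ℝ) ^ 2 ≤ ((d : ℝ) / r) ^ ((z : ℝ) / r / 12)) :
    HasModel (⊤ : SimpleGraph (Fin k)) Γ := by
  classical
  -- The largest R with r * (4R + 2) ≤ z; since 2r ≤ z, the natural subtraction does not truncate.
  set R := (z / r - 2) / 4 with hR
  have hr0 : 0 < r := by omega
  have hq : 2 ≤ z / r := (Nat.le_div_iff_mul_le hr0).2 hz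
  have hzR : r * (4 * R + 1) < z := by
    have h1 : r * (z / r) ≤ z := Nat.mul_div_le z r
    have h2 : 4 * R + 2 ≤ z / r := by omega
    nlinarith
  obtain ⟨T⟩ := exists_voronoiForest Γ R
  have : Nonempty {c : V // T.root c = c} :=
    ⟨⟨T.root (Classical.arbitrary V), T.root_root _⟩⟩
  refine (hasModel_top_of_le_degree hk T.quotient fun c => ?_).trans T.hasModel_quotient
  have hdeg := T.le_degree_quotient hr hrd hΓ hzR hd c
  have hrR : (0 : ℝ) < r := by exact_mod_cast hr0
  have hx3 : (3 : ℝ) ≤ (d : ℝ) / r := by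
    rw [le_div_iff₀ hrR]
    exact_mod_cast hrd
  have hzr : (z : ℝ) / r ≤ 4 * R + 6 := by
    rw [div_le_iff₀ hrR]
    have h1 : z < r * (z / r + 1) := Nat.lt_mul_div_succ z hr0
    have h2 : z / r + 1 ≤ 4 * R + 6 := by omega
    have h3 : z ≤ (4 * R + 6) * r := by nlinarith
    exact_mod_cast h3
  generalize (d : ℝ) / r = x at *
  have hx0 : 0 ≤ x := by linarith
  -- From z/r ≤ 4R + 6 the exponent is at most R/3 + 1/2.
  have h1 : x ^ ((z : ℝ) / r / 12) ≤ x ^ (1 + (R : ℝ) / 2) := by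
    apply Real.rpow_le_rpow_of_exponent_le (by linarith)
    have : (0 : ℝ) ≤ R := Nat.cast_nonneg _
    linarith
  -- For x ≥ 3 one has √x ≤ x - 1.
  have h2 : x ^ (1 + (R : ℝ) / 2) ≤ x * (x - 1) ^ R := by
    rw [Real.rpow_add (by linarith), Real.rpow_one]
    refine mul_le_mul_of_nonneg_left ?_ hx0
    have h3 : x ^ ((R : ℝ) / 2) = (√x) ^ R := by
      rw [Real.sqrt_eq_rpow, ← Real.rpow_natCast, ← Real.rpow_mul hx0]
      congr 1
      ring
    rw [h3]
    refine pow_le_pow_left₀ (Real.sqrt_nonneg _) ?_ _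
    rw [Real.sqrt_le_left (by linarith)]
    nlinarith
  have h3 : (24 * (k : ℝ) ^ 2) ≤ (T.quotient.neighborSet c).ncard := by
    refine le_trans ?_ hdeg
    linarith
  exact_mod_cast h3

/-- With y = (d/r)^(z/(120r)), any k ≥ y suffices, as the denominator is at least 1. If y ≤ 2, a
single edge serves. Otherwise ⌈y⌉ ≤ 3y/2, and 72 * (3y/2)² = 162y² ≤ y¹⁰ because y⁸ ≥ 256; the tenth
power is the ratio of 120 to 12. -/
lemma exists_clique_order {r d z : ℕ} (hr : 2 ≤ r) (hrd : 3 * r ≤ d) (hz : 2 * r ≤ z) :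
    ∃ k : ℕ, 0 < k ∧ ((d : ℝ) / r) ^ ((1 / 120 : ℝ) * ((z : ℝ) / r)) /
        √(((z : ℝ) / r) * Real.logb 2 d) ≤ (k : ℝ) ∧
      (k = 2 ∨ 72 * (k : ℝ) ^ 2 ≤ ((d : ℝ) / r) ^ ((z : ℝ) / r / 12)) := by
  have hrR : (0 : ℝ) < r := by exact_mod_cast (by omega : 0 < r)
  have hx3 : (3 : ℝ) ≤ (d : ℝ) / r := by
    rw [le_div_iff₀ hrR]
    exact_mod_cast hrd
  have hz2 : (2 : ℝ) ≤ (z : ℝ) / r := by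
    rw [le_div_iff₀ hrR]
    exact_mod_cast hz
  have hlog : 1 ≤ Real.logb 2 d := by
    rw [Real.le_logb_iff_rpow_le one_lt_two (by exact_mod_cast (by omega : 0 < d)), Real.rpow_one]
    exact_mod_cast (by omega : 2 ≤ d)
  have hsqrt : 1 ≤ √(((z : ℝ) / r) * Real.logb 2 d) := Real.one_le_sqrt.2 (by nlinarith)
  set y := ((d : ℝ) / r) ^ ((1 / 120 : ℝ) * ((z : ℝ) / r)) with hy
  have hy0 : 0 < y := Real.rpow_pos_of_pos (by linarith) _
  have hpow : ((d : ℝ) / r) ^ ((z : ℝ) / r / 12) = y ^ 10 := by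
    rw [hy, ← Real.rpow_natCast, ← Real.rpow_mul (by linarith)]
    congr 1
    push_cast
    ring
  have hle : y / √(((z : ℝ) / r) * Real.logb 2 d) ≤ y := div_le_self hy0.le hsqrt
  by_cases h2 : y ≤ 2
  · exact ⟨2, two_pos, hle.trans (by exact_mod_cast h2), Or.inl rfl⟩
  push Not at h2
  refine ⟨⌈y⌉₊, Nat.ceil_pos.2 hy0, hle.trans (Nat.le_ceil y), Or.inr ?_⟩
  have h3 : (⌈y⌉₊ : ℝ) ≤ 3 / 2 * y := by
    have := Nat.ceil_lt_add_one hy0.le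
    linarith
  rw [hpow]
  have h4 : (256 : ℝ) ≤ y ^ 8 := by
    have := pow_le_pow_left₀ (by norm_num) h2.le 8
    norm_num at this
    exact this
  calc 72 * (⌈y⌉₊ : ℝ) ^ 2 ≤ 72 * (3 / 2 * y) ^ 2 := by gcongr
    _ = 162 * y ^ 2 := by ring
    _ ≤ y ^ 8 * y ^ 2 := by
      apply mul_le_mul_of_nonneg_right (by linarith) (by positivity)
    _ = y ^ 10 := by ring

end Main

lemma le_ncard_neighborSet_of_minDegree_eq {α : Type u} {β : Type v} {G : Graph α β} [G.Loopless]
    {d : ℕ} (hd : minDegree G = d) (v : V(G)) :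
    d ≤ (G.toSimpleGraph.neighborSet v).ncard := by
  have h1 : d ≤ degree G v := hd ▸ Nat.sInf_le ⟨v, v.2, rfl⟩
  have h2 : {y | G.Adj v y} = Subtype.val '' G.toSimpleGraph.neighborSet v := by
    ext y
    constructor
    · intro h
      exact ⟨⟨y, h.right_mem⟩, (Graph.toSimpleGraph_adj_iff _ _).2 h, rfl⟩
    · rintro ⟨y, h, rfl⟩
      exact (Graph.toSimpleGraph_adj_iff _ _).1 h
  rwa [degree, h2, Set.ncard_image_of_injective _ Subtype.val_injective] at h1

end ThetaGirth

theorem theorem1 :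
    ∃ c : ℝ, 0 < c ∧
      ∀ (r d z : ℕ), 2 ≤ r → 3 * r ≤ d → 2 * r ≤ z →
        ∀ (α : Type*) (β : Type*) (G : Graph α β),
          V(G).Finite → E(G).Finite → G.Loopless →
          ThetaGirth.minDegree G = d →
          (z : ℕ∞) ≤ ThetaGirth.girth (ThetaGirth.theta r) G →
          ∃ k : ℕ,
            ((d : ℝ) / r) ^ (c * ((z : ℝ) / r)) / √(((z : ℝ) / r) * Real.logb 2 d) ≤ (k : ℝ) ∧
            ThetaGirth.IsMinor (ThetaGirth.clique k) G := by
  refine ⟨1 / 120, by norm_num, ?_⟩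
  intro r d z hr hrd hz α β G hV hE hloop hd hgirth
  have hdeg := ThetaGirth.le_ncard_neighborSet_of_minDegree_eq hd
  -- The graph without vertices has minimum degree 0 by convention, while d ≥ 6.
  have hne : V(G).Nonempty := by
    by_contra h
    rw [Set.not_nonempty_iff_eq_empty] at h
    rw [ThetaGirth.minDegree, h, Set.image_empty, Nat.sInf_empty] at hd
    omega
  have hfin : Fintype V(G) := hV.fintype
  have hne' : Nonempty V(G) := hne.to_subtype
  obtain ⟨a, b, hab⟩ : ∃ a b, G.toSimpleGraph.Adj a b := by
    obtain ⟨a⟩ := hne'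
    have h1 : 0 < (G.toSimpleGraph.neighborSet a).ncard := by
      have := hdeg a
      omega
    obtain ⟨b, hb⟩ := Set.nonempty_of_ncard_ne_zero h1.ne'
    exact ⟨a, b, hb⟩
  obtain ⟨e, -⟩ := (Graph.toSimpleGraph_adj_iff a b).1 hab
  have hβ : Nonempty β := ⟨e⟩
  obtain ⟨k, hk0, hk, hk'⟩ := ThetaGirth.exists_clique_order hr hrd hz
  refine ⟨k, hk, ThetaGirth.isMinor_clique_of_hasModel hV hE ?_⟩
  rcases hk' with rfl | hk'
  · exact ThetaGirth.hasModel_top_fin_two hab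
  · refine ThetaGirth.hasModel_top_of_thetaSparse hr hrd hz ?_ hdeg hk0 hk'
    intro A B hAB P Q hP hQ hPG hQG F hF hFG
    exact ThetaGirth.le_card_of_le_girth_theta hV hE (by omega) hgirth hAB hP hQ hPG hQG hF hFG
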